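/- Let $d\ge 1$, $0<\alpha<2$, $m\ge 0$, $v>0$, $a>0$, and let $\mathcal B_a\subset\mathbb R^d$ be the ball of radius $a$ centred at the origin. Put $\Phi_{m,\alpha}(z)=(z+m^{2/\alpha})^{\alpha/2}-m$ for $z\ge 0$, and let $L_{m,\alpha}=\Phi_{m,\alpha}(-\Delta)=(-\Delta+m^{2/\alpha})^{\alpha/2}-m$ be the operator in $L^2(\mathbb R^d)$ defined by $\widehat{L_{m,\alpha}f}(y)=\Phi_{m,\alpha}(|y|^2)\widehat f(y)$ on the domain $\{f\in L^2(\mathbb R^d):\Phi_{m,\alpha}(|\cdot|^2)\widehat f\in L^2(\mathbb R^d)\}$ (where $\widehat f(y)$ is, up to a constant factor, $\int e^{-ix\cdot y}f(x)\,dx$). Let $H_{m,\alpha}=L_{m,\alpha}-v\mathbf 1_{\mathcal B_a}$, with the same domain. Suppose that $H_{m,\alpha}$ has a ground state $\varphi_0$, i.e. a non-zero $\varphi_0\in\mathrm{Dom}(H_{m,\alpha})$ with $H_{m,\alpha}\varphi_0=\lambda_0\varphi_0$, where $\lambda_0=\inf\mathrm{Spec}\,H_{m,\alpha}$. Then $\varphi_0$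 is rotationally symmetric, i.e. $\varphi_0(x)$ depends on $|x|$ only: $\varphi_0$ is equal almost everywhere to a function $f$ with $f(\mathsf Rx)=f(x)$ for all $x\in\mathbb R^d$ and all linear isometries $\mathsf R$ of $\mathbb R^d$, and every continuous version of $\varphi_0$ has this property at every point. -/

import Mathlib

open MeasureTheory
open scoped ENNReal

noncomputable section

namespace RelSchrodinger

/-- The symbol `Φ_{m,α}(z) = (z + m^{2/α})^{α/2} - m`, for `z ≥ 0`; for `m = 0` it is `z^{α/2}`. -/
def symbol (m α z : ℝ) : ℝ := (z + m ^ (2 / α)) ^ (α / 2) - m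

/-- The complex Hilbert space `L²(ℝᵈ)`. -/
abbrev L2 (d : ℕ) : Type := Lp (α := EuclideanSpace ℝ (Fin d)) ℂ 2 volume

/-- The multiplier of `L_{m,α} = Φ_{m,α}(-Δ)` in the frequency variable of the Fourier transform
`𝓕 f ξ = ∫ exp(-2πi⟨x, ξ⟩) f x dx`, for which `-Δ` is multiplication by `(2π|ξ|)²`. -/
def multiplier (d : ℕ) (m α : ℝ) (ξ : EuclideanSpace ℝ (Fin d)) : ℂ :=
  (symbol m α ((2 * Real.pi * ‖ξ‖) ^ 2) : ℂ)

/-- The maximal domain `{f ∈ L² : w f ∈ L²}` of multiplication by the function `w`. -/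
def mulDomain {d : ℕ} (w : EuclideanSpace ℝ (Fin d) → ℂ) : Submodule ℂ (L2 d) where
  carrier := {f | MemLp (fun ξ => w ξ * f ξ) 2 volume}
  add_mem' := by
    intro f g hf hg
    refine (MemLp.add hf hg).ae_eq ?_
    filter_upwards [Lp.coeFn_add f g] with ξ hξ
    rw [hξ, Pi.add_apply, Pi.add_apply, mul_add]
  zero_mem' := by
    refine (MemLp.zero (p := 2) (μ := volume)).ae_eq ?_
    filter_upwards [Lp.coeFn_zero ℂ 2 (volume : Measure (EuclideanSpace ℝ (Fin d)))] with ξ hξ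
    rw [hξ, Pi.zero_apply, mul_zero]
  smul_mem' := by
    intro c f hf
    refine (MemLp.const_smul hf c).ae_eq ?_
    filter_upwards [Lp.coeFn_smul c f] with ξ hξ
    rw [hξ, Pi.smul_apply, Pi.smul_apply, mul_smul_comm]

theorem mulDomain_memLp {d : ℕ} {w : EuclideanSpace ℝ (Fin d) → ℂ} (f : mulDomain w) :
    MemLp (fun ξ => w ξ * (f : L2 d) ξ) 2 volume := f.2

/-- Multiplication by a function `w`, on its maximal domain. -/
def mulOp {d : ℕ} (w : EuclideanSpace ℝ (Fin d) → ℂ) : L2 d →ₗ.[ℂ] L2 d where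
  domain := mulDomain w
  toFun :=
    { toFun := fun f => MemLp.toLp (fun ξ => w ξ * (f : L2 d) ξ) (mulDomain_memLp f)
      map_add' := by
        intro f g
        refine Eq.trans ?_ (MemLp.toLp_add (mulDomain_memLp f) (mulDomain_memLp g))
        refine MemLp.toLp_congr _ _ ?_
        filter_upwards [Lp.coeFn_add (f : L2 d) (g : L2 d)] with ξ hξ
        rw [Submodule.coe_add, hξ, Pi.add_apply, Pi.add_apply, mul_add]
      map_smul' := by
        intro c f
        refine Eq.trans ?_ (MemLp.toLp_const_smul c (mulDomain_memLp f))
        refine MemLp.toLp_congr _ _ ?_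
        filter_upwards [Lp.coeFn_smul c (f : L2 d)] with ξ hξ
        rw [Submodule.coe_smul, hξ, Pi.smul_apply, Pi.smul_apply, mul_smul_comm] }

/-- The unitary Fourier transform on `L²(ℝᵈ)`. -/
def fourierL2 (d : ℕ) : L2 d ≃ₗᵢ[ℂ] L2 d :=
  Lp.fourierTransformₗᵢ (EuclideanSpace ℝ (Fin d)) ℂ

/-- The free operator `L_{m,α} = (-Δ + m^{2/α})^{α/2} - m` on its maximal domain
`{f ∈ L² : Φ_{m,α}(|·|²) f̂ ∈ L²}`, acting as a Fourier multiplier. -/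
def freeOp (d : ℕ) (m α : ℝ) : L2 d →ₗ.[ℂ] L2 d where
  domain := (mulOp (multiplier d m α)).domain.comap (fourierL2 d).toLinearEquiv.toLinearMap
  toFun := (fourierL2 d).symm.toLinearEquiv.toLinearMap ∘ₗ (mulOp (multiplier d m α)).toFun ∘ₗ
    (fourierL2 d).toLinearEquiv.toLinearMap.restrict fun _ h => h

/-- Multiplication by the indicator function of a measurable set `K`, as an operator on `L²`. -/
def indicatorMul {d : ℕ} {K : Set (EuclideanSpace ℝ (Fin d))} (hK : MeasurableSet K) :
    L2 d →ₗ[ℂ] L2 d where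
  toFun f := MemLp.toLp (K.indicator f) ((Lp.memLp f).indicator hK)
  map_add' f g := by
    rw [← MemLp.toLp_add]
    refine MemLp.toLp_congr _ _ ?_
    filter_upwards [Lp.coeFn_add f g] with x hx
    rw [Pi.add_apply]
    by_cases h : x ∈ K
    · simp only [Set.indicator_of_mem h]
      rw [hx, Pi.add_apply]
    · simp only [Set.indicator_of_notMem h, add_zero]
  map_smul' c f := by
    rw [RingHom.id_apply, ← MemLp.toLp_const_smul]
    refine MemLp.toLp_congr _ _ ?_
    filter_upwards [Lp.coeFn_smul c f] with x hx
    rw [Pi.smul_apply]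
    by_cases h : x ∈ K
    · simp only [Set.indicator_of_mem h]
      rw [hx, Pi.smul_apply]
    · simp only [Set.indicator_of_notMem h, smul_zero]

/-- The relativistic Schrödinger operator `H_{m,α} = L_{m,α} - v 1_K` with a potential well of
depth `v` supported in `K`. The potential is bounded, so the domain is that of `L_{m,α}`. -/
def wellOp {d : ℕ} (m α v : ℝ) {K : Set (EuclideanSpace ℝ (Fin d))} (hK : MeasurableSet K) :
    L2 d →ₗ.[ℂ] L2 d where
  domain := (freeOp d m α).domain
  toFun := (freeOp d m α).toFun
    - ((v : ℂ) • indicatorMul hK).comp (freeOp d m α).domain.subtype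

/-- `z` lies in the resolvent set of the (possibly unbounded) operator `A`: the map
`z - A : Dom A → E` is bijective with a bounded inverse. -/
def InResolventSet {E : Type*} [NormedAddCommGroup E] [NormedSpace ℂ E]
    (A : E →ₗ.[ℂ] E) (z : ℂ) : Prop :=
  ∃ R : E →L[ℂ] E,
    (∀ y : E, ∃ h : R y ∈ A.domain, z • R y - A ⟨R y, h⟩ = y) ∧
    ∀ x : A.domain, R (z • (x : E) - A x) = x

/-- The real points of the spectrum of `A` (all of the spectrum when `A` is self-adjoint). -/
def realSpec {E : Type*} [NormedAddCommGroup E] [NormedSpace ℂ E]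
    (A : E →ₗ.[ℂ] E) : Set ℝ :=
  {t | ¬ InResolventSet A (t : ℂ)}

/-- `φ` is a ground state of `A`: a non-zero element of `Dom A` with `A φ = λ₀ φ`, where
`λ₀ = inf Spec A`. -/
def IsGroundState {E : Type*} [NormedAddCommGroup E] [NormedSpace ℂ E]
    (A : E →ₗ.[ℂ] E) (φ : E) : Prop :=
  φ ≠ 0 ∧ ∃ lam : ℝ, IsGLB (realSpec A) lam ∧ ∃ h : φ ∈ A.domain, A ⟨φ, h⟩ = (lam : ℂ) • φ

/-- A function on `ℝᵈ` is rotationally symmetric (radial) if it is invariant under all linear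
isometries; equivalently, its value at `x` depends on `|x|` only. -/
def RotationallySymmetric {d : ℕ} (f : EuclideanSpace ℝ (Fin d) → ℂ) : Prop :=
  ∀ (R : EuclideanSpace ℝ (Fin d) ≃ₗᵢ[ℝ] EuclideanSpace ℝ (Fin d))
    (x : EuclideanSpace ℝ (Fin d)), f (R x) = f x

end RelSchrodinger

end

/-!
The ground state is studied through the quadratic form `q f = ∫ Φ(|2πξ|²) |𝓕 f ξ|² dξ - v ∫_K |f|²`
of `H = L_{m,α} - v 1_K`, by the variational form of the Perron–Frobenius argument.

A lower bound `λ₀` of the spectrum of `H` satisfies `λ₀ ‖f‖² ≤ q f` whenever `q f` is finite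
(`le_re_inner_of_mem_lowerBounds_realSpec` on the operator domain, `le_energy_of_mem_lowerBounds` in
general), so a ground state is a minimizer of `q f - λ₀ ‖f‖²`.

The symbol is a Bernstein function, `Φ(z) = C ∫ (1 - exp (-tz)) ν(t) dt` with `ν > 0`
(`exists_lintegral_levyDensity_eq_symbol`). Hence the energy of `L_{m,α}` is a mixture of the forms
`‖f‖² - ⟪exp (tΔ) f, f⟫` (`exists_mul_energy_eq`). As `exp (tΔ)` has a strictly positive, rotation
invariant kernel, the energy is rotation invariant, it does not increase when `f` is replaced by
`|f|` (`energy_le_of_ae_eq_norm`), and equality occurs only if `f` has a constant phase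
(`ae_eq_norm_of_energy_eq`). Thus every minimizer has a constant phase and its
modulus is a minimizer.

Minimizers form a linear subspace invariant under rotations. For a minimizer `f` and an
isometry `R`, the function `|f| - |f| ∘ R` is therefore a minimizer; being real with a constant phase, it has a
constant sign, and it is zero since `|f|` and `|f| ∘ R` have equal norms. With the constant phase
of `f` this gives `f ∘ R = f` almost everywhere (`IsFormMinimizer.comp_ae_eq`). The limits of the
averages over balls then give a version that is invariant at every point.
-/

noncomputable section

namespace RelSchrodinger

open scoped InnerProductSpace ComplexConjugate FourierTransform SchwartzMap

/-! ### From the spectrum to the quadratic form -/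

/-- A symmetric operator that is semibounded (by some constant, `-C`) is bounded below, as a form,
by every lower bound of its real spectrum. The bounded self-adjoint operator `T = (A + c)⁻¹`, for
`c` large, has spectrum in `[-1/(lam + c), 1/(lam + c)]`, so its norm, which is its spectral radius,
is at most `1 / (lam + c)`; positivity of `T` turns the norm bound into the form bound. -/
theorem le_re_inner_of_mem_lowerBounds_realSpec {E : Type*} [NormedAddCommGroup E]
    [InnerProductSpace ℂ E] [CompleteSpace E] {A : E →ₗ.[ℂ] E}
    (hsym : ∀ x y : A.domain, ⟪A x, (y : E)⟫_ℂ = ⟪(x : E), A y⟫_ℂ) {C : ℝ}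
    (hC : ∀ x : A.domain, -C * ‖(x : E)‖ ^ 2 ≤ (⟪A x, (x : E)⟫_ℂ).re) {lam : ℝ}
    (hlam : lam ∈ lowerBounds (realSpec A)) (x : A.domain) :
    lam * ‖(x : E)‖ ^ 2 ≤ (⟪A x, (x : E)⟫_ℂ).re := by
  have hres : ∀ t : ℝ, t < lam → InResolventSet A (t : ℂ) := fun t ht => by
    by_contra h
    exact absurd (hlam h) (not_le.2 ht)
  set c : ℝ := |lam| + |C| + 1 with hc
  have hlc : 0 < lam + c := by
    have := neg_abs_le lam
    have := abs_nonneg C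
    linarith
  have hcC : C ≤ c := by
    have := le_abs_self C
    have := abs_nonneg lam
    linarith
  -- `R = (-c - A)⁻¹`, so that `-R = (A + c)⁻¹`
  obtain ⟨R, hR, hR'⟩ := hres (-c) (by linarith)
  choose hRd hRe using hR
  set T : E →L[ℂ] E := -R with hT
  have hTd : ∀ y, T y ∈ A.domain := fun y => by
    simpa [hT] using A.domain.neg_mem (hRd y)
  have hTe : ∀ y, A ⟨T y, hTd y⟩ + (c : ℂ) • T y = y := fun y => by
    have h1 : A ⟨T y, hTd y⟩ = - A ⟨R y, hRd y⟩ := by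
      rw [← LinearPMap.map_neg]; rfl
    have h2 := hRe y
    rw [h1]
    simp only [hT, neg_apply, smul_neg]
    refine Eq.trans ?_ h2
    push_cast
    module
  have hTl : ∀ u : A.domain, T (A u + (c : ℂ) • (u : E)) = u := fun u => by
    have h2 := hR' u
    have : A u + (c : ℂ) • (u : E) = -(((-c : ℝ) : ℂ) • (u : E) - A u) := by
      push_cast; module
    rw [this, map_neg, hT, neg_apply, h2, neg_neg]
  have hTsym : ∀ y z, ⟪T y, z⟫_ℂ = ⟪y, T z⟫_ℂ := fun y z => by
    conv_lhs => rw [← hTe z]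
    conv_rhs => rw [← hTe y]
    rw [inner_add_right, inner_add_left, inner_smul_left, inner_smul_right,
      ← hsym ⟨T y, hTd y⟩ ⟨T z, hTd z⟩]
    simp
  have hTpos : ∀ y, 0 ≤ (⟪T y, y⟫_ℂ).re := fun y => by
    have h1 := hC ⟨T y, hTd y⟩
    have h2 : (⟪T y, y⟫_ℂ).re = (⟪A ⟨T y, hTd y⟩, T y⟫_ℂ).re + c * ‖T y‖ ^ 2 := by
      have h3 : ⟪T y, y⟫_ℂ = ⟪T y, A ⟨T y, hTd y⟩ + (c : ℂ) • T y⟫_ℂ := by rw [hTe y]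
      rw [h3, inner_add_right, inner_smul_right, ← hsym ⟨T y, hTd y⟩ ⟨T y, hTd y⟩, Complex.add_re,
        inner_self_eq_norm_sq_to_K]
      congr 1
      simp only [Complex.coe_algebraMap, ← Complex.ofReal_pow, Complex.re_ofReal_mul,
        Complex.ofReal_re]
    rw [h2]
    have := mul_nonneg (sub_nonneg.2 hcC) (sq_nonneg ‖T y‖)
    simp only at h1
    linarith
  have hTsa : IsSelfAdjoint T := by
    rw [ContinuousLinearMap.isSelfAdjoint_iff_isSymmetric]
    exact hTsym
  -- the spectrum of `T` is controlled by that of `A` through `μ ↦ 1 / μ - c`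
  have hspec : ∀ z ∈ spectrum ℂ T, ‖z‖ ≤ 1 / (lam + c) := fun z hz => by
    by_contra! hlt
    have hzre := hTsa.mem_spectrum_eq_re hz
    set r : ℝ := z.re with hr
    have hr0 : r ≠ 0 := by
      rintro h0
      rw [hzre, h0] at hlt
      simp only [Complex.ofReal_zero, norm_zero] at hlt
      exact absurd hlt (not_lt.2 (by positivity))
    have hrinv : r⁻¹ < lam + c := by
      rcases lt_or_gt_of_ne hr0 with h | h
      · exact (inv_lt_zero.2 h).trans hlc
      · rw [hzre, Complex.norm_real, Real.norm_of_nonneg h.le, one_div] at hlt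
        exact inv_lt_of_inv_lt₀ hlc hlt
    obtain ⟨S, hS, hS'⟩ := hres (r⁻¹ - c) (by linarith)
    choose hSd hSe using hS
    refine hz ?_
    have hrc : (r : ℂ) ≠ 0 := by exact_mod_cast hr0
    have key1 : ∀ y, (z • y - T y) = -(z • (((r⁻¹ - c : ℝ) : ℂ) • T y - A ⟨T y, hTd y⟩)) := by
      intro y
      have h1 : A ⟨T y, hTd y⟩ = y - (c : ℂ) • T y := eq_sub_of_add_eq (hTe y)
      rw [h1, hzre]
      push_cast
      match_scalars <;> field_simp <;> ring
    have hST : ∀ y, S (z • y - T y) = -(z • T y) := fun y => by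
      rw [key1, map_neg, map_smul, hS' ⟨T y, hTd y⟩]
    have hTS : ∀ y, z⁻¹ • T (S y) - T y = S y := fun y => by
      have h1 := hTl ⟨S y, hSd y⟩
      have h2 : A ⟨S y, hSd y⟩ + (c : ℂ) • S y = z⁻¹ • S y - y := by
        conv_rhs => enter [2]; rw [← hSe y]
        rw [hzre]
        push_cast
        module
      simp only at h1
      rwa [h2, map_sub, map_smul] at h1
    have hz0 : z ≠ 0 := by rw [hzre]; exact hrc
    -- from `z - T = -z (1/z - c - A) T` the inverse of `z - T` is read off as `z⁻¹ (1 - z⁻¹ S)`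
    refine ⟨⟨algebraMap ℂ (E →L[ℂ] E) z - T, z⁻¹ • (1 - z⁻¹ • S), ?_, ?_⟩, rfl⟩
    · ext y
      have h1 := hTS y
      simp only [Algebra.algebraMap_eq_smul_one, mul_apply_eq_comp, sub_apply,
        smul_apply, one_apply_eq_self, map_smul, map_sub]
      rw [← sub_eq_zero] at h1
      rw [← sub_eq_zero, ← smul_zero z⁻¹, ← h1]
      match_scalars <;> field_simp <;> ring
    · ext y
      have h1 := hST y
      simp only [Algebra.algebraMap_eq_smul_one, mul_apply_eq_comp, sub_apply,
        smul_apply, one_apply_eq_self] at h1 ⊢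
      rw [h1]
      match_scalars <;> field_simp <;> ring
  have hK : 0 < 1 / (lam + c) := by positivity
  have hnorm : ‖T‖ ≤ 1 / (lam + c) := by
    have h1 := hTsa.spectralRadius_eq_nnnorm
    have h2 : spectralRadius ℂ T ≤ (Real.toNNReal (1 / (lam + c)) : ℝ≥0∞) := by
      refine iSup₂_le fun z hz => ?_
      rw [ENNReal.coe_le_coe, Real.le_toNNReal_iff_coe_le hK.le]
      exact hspec z hz
    rw [h1, ENNReal.coe_le_coe, Real.le_toNNReal_iff_coe_le hK.le] at h2
    exact h2
  set K := 1 / (lam + c) with hKdef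
  set y : E := A x + (c : ℂ) • (x : E) with hy
  have hTy : T y = x := hTl x
  -- `‖T y‖² ≤ K ⟪T y, y⟫`, from positivity of `T` at `y - K⁻¹ T y`
  have hexp := hTpos (y - ((K⁻¹ : ℝ) : ℂ) • (x : E))
  have hTT : (⟪T (x : E), (x : E)⟫_ℂ).re ≤ K * ‖(x : E)‖ ^ 2 := by
    refine (Complex.re_le_norm _).trans ((norm_inner_le_norm _ _).trans ?_)
    have := T.le_opNorm (x : E)
    have h2 := mul_le_mul_of_nonneg_right hnorm (norm_nonneg (x : E))
    nlinarith [norm_nonneg (x : E)]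
  have hTxy : ⟪T (x : E), y⟫_ℂ = ((‖(x : E)‖ ^ 2 : ℝ) : ℂ) := by
    rw [hTsym, hTy, inner_self_eq_norm_sq_to_K]; norm_cast
  have hxx : ⟪(x : E), (x : E)⟫_ℂ = ((‖(x : E)‖ ^ 2 : ℝ) : ℂ) := by
    rw [inner_self_eq_norm_sq_to_K]; norm_cast
  have hxy : (⟪(x : E), y⟫_ℂ).re = (⟪A x, (x : E)⟫_ℂ).re + c * ‖(x : E)‖ ^ 2 := by
    rw [hy, inner_add_right, inner_smul_right, hxx, ← hsym, Complex.add_re, ← Complex.ofReal_mul,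
      Complex.ofReal_re]
  rw [map_sub, map_smul, hTy, inner_sub_left, inner_sub_right, inner_sub_right, inner_smul_right,
    inner_smul_right, inner_smul_left, inner_smul_left, hTxy, hxx, Complex.conj_ofReal] at hexp
  simp only [Complex.sub_re, Complex.re_ofReal_mul, Complex.ofReal_re, hxy] at hexp
  have h5 : K⁻¹ * (K⁻¹ * (⟪T (x : E), (x : E)⟫_ℂ).re) ≤ K⁻¹ * ‖(x : E)‖ ^ 2 := by
    refine mul_le_mul_of_nonneg_left ?_ (inv_nonneg.2 hK.le)
    rw [inv_mul_le_iff₀ hK]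
    exact hTT
  have h6 : K⁻¹ = lam + c := by rw [hKdef]; simp
  rw [h6] at h5 hexp
  linarith

/-! ### Lévy representation of the symbol -/

theorem integrableOn_rpow_mul_one_sub_exp {β : ℝ} (h0 : 0 < β) (h1 : β < 1) :
    IntegrableOn (fun t : ℝ => t ^ (-1 - β) * (1 - Real.exp (-t))) (Set.Ioi 0) := by
  rw [← Set.Ioc_union_Ioi_eq_Ioi zero_le_one]
  have hmeas : Measurable (fun t : ℝ => t ^ (-1 - β) * (1 - Real.exp (-t))) := by fun_prop
  refine IntegrableOn.union ?_ ?_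
  · refine Integrable.mono' (g := fun t : ℝ => t ^ (-β)) ?_ hmeas.aestronglyMeasurable ?_
    · have := (intervalIntegral.intervalIntegrable_rpow' (a := 0) (b := 1)
        (r := -β) (by linarith))
      rwa [intervalIntegrable_iff_integrableOn_Ioc_of_le zero_le_one] at this
    · refine (ae_restrict_iff' measurableSet_Ioc).2 (ae_of_all _ fun t ht => ?_)
      have ht0 : 0 < t := ht.1
      have h2 : 1 - Real.exp (-t) ≤ t := by linarith [Real.add_one_le_exp (-t)]
      have h3 : 0 ≤ 1 - Real.exp (-t) := by simp [ht0.le]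
      rw [Real.norm_of_nonneg (by positivity)]
      calc t ^ (-1 - β) * (1 - Real.exp (-t)) ≤ t ^ (-1 - β) * t := by gcongr
        _ = t ^ (-β) := by rw [← Real.rpow_add_one ht0.ne']; congr 1; ring
  · refine Integrable.mono' (g := fun t : ℝ => t ^ (-1 - β)) ?_ hmeas.aestronglyMeasurable ?_
    · exact integrableOn_Ioi_rpow_of_lt (by linarith) one_pos
    · refine (ae_restrict_iff' measurableSet_Ioi).2 (ae_of_all _ fun t ht => ?_)
      have ht0 : 0 < t := one_pos.trans ht
      have h3 : 0 ≤ 1 - Real.exp (-t) := by simp [ht0.le]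
      rw [Real.norm_of_nonneg (by positivity)]
      exact mul_le_of_le_one_right (by positivity) (by linarith [Real.exp_pos (-t)])

/-- `s ^ β` is a constant times `∫ t ^ (-1 - β) (1 - exp (-s t)) dt`, by scaling. The value
`Γ(1 - β) / β` of the constant `k` is irrelevant; only `0 < k < ∞` is used. -/
theorem exists_lintegral_one_sub_exp_eq {β : ℝ} (h0 : 0 < β) (h1 : β < 1) :
    ∃ k : ℝ≥0∞, k ≠ 0 ∧ k ≠ ∞ ∧ ∀ s : ℝ, 0 ≤ s →
      ∫⁻ t in Set.Ioi (0 : ℝ), ENNReal.ofReal (t ^ (-1 - β) * (1 - Real.exp (-(s * t)))) =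
        k * ENNReal.ofReal (s ^ β) := by
  have hint := integrableOn_rpow_mul_one_sub_exp h0 h1
  have hpos : ∀ t ∈ Set.Ioi (0 : ℝ), 0 < t ^ (-1 - β) * (1 - Real.exp (-t)) := fun t ht => by
    have ht : 0 < t := ht
    have : 0 < 1 - Real.exp (-t) := by simp [ht]
    positivity
  set I := ∫ t in Set.Ioi (0 : ℝ), t ^ (-1 - β) * (1 - Real.exp (-t)) with hI
  have hIpos : 0 < I := by
    rw [hI, setIntegral_pos_iff_support_of_nonneg_ae
      ((ae_restrict_iff' measurableSet_Ioi).2 (ae_of_all _ fun t ht => (hpos t ht).le)) hint]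
    rw [Set.inter_eq_right.2 (show Set.Ioi (0 : ℝ) ⊆ Function.support _ from
      fun t ht => (hpos t ht).ne')]
    simp
  refine ⟨ENNReal.ofReal I, by simpa using hIpos, ENNReal.ofReal_ne_top, fun s hs => ?_⟩
  rcases hs.eq_or_lt with rfl | hs
  · simp [Real.zero_rpow h0.ne']
  have hsc : ∀ t ∈ Set.Ioi (0 : ℝ), t ^ (-1 - β) * (1 - Real.exp (-(s * t))) =
      s ^ (1 + β) * ((s * t) ^ (-1 - β) * (1 - Real.exp (-(s * t)))) := fun t ht => by
    have ht : 0 < t := ht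
    rw [Real.mul_rpow hs.le ht.le, ← mul_assoc, ← mul_assoc, ← Real.rpow_add hs]
    simp
  have hint' : IntegrableOn (fun t : ℝ => (s * t) ^ (-1 - β) * (1 - Real.exp (-(s * t))))
      (Set.Ioi 0) := by
    have := (integrableOn_Ioi_comp_mul_left_iff
      (fun t : ℝ => t ^ (-1 - β) * (1 - Real.exp (-t))) 0 hs).2 (by simpa using hint)
    exact this
  rw [setLIntegral_congr_fun measurableSet_Ioi fun t ht => by rw [hsc t ht],
    ← ofReal_integral_eq_lintegral_ofReal (hint'.const_mul _)
      ((ae_restrict_iff' measurableSet_Ioi).2 (ae_of_all _ fun t ht => ?_)),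
    ← ENNReal.ofReal_mul hIpos.le]
  · congr 1
    rw [integral_const_mul, integral_comp_mul_left_Ioi
      (fun t : ℝ => t ^ (-1 - β) * (1 - Real.exp (-t))) 0 hs, mul_zero, ← hI, smul_eq_mul,
      Real.rpow_add hs, Real.rpow_one]
    field_simp
  · have ht : 0 < t := ht
    have := hpos (s * t) (mul_pos hs ht)
    simp only [Pi.zero_apply]
    positivity

theorem symbol_nonneg {m α z : ℝ} (hα : 0 < α) (hm : 0 ≤ m) (hz : 0 ≤ z) :
    0 ≤ symbol m α z := by
  have h : (m ^ (2 / α)) ^ (α / 2) = m := by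
    rw [← Real.rpow_mul hm]
    rw [show 2 / α * (α / 2) = 1 by field_simp, Real.rpow_one]
  rw [symbol, sub_nonneg]
  calc m = (m ^ (2 / α)) ^ (α / 2) := h.symm
    _ ≤ _ := Real.rpow_le_rpow (by positivity) (by linarith) (by positivity)

/-- The density of the Lévy measure of the Bernstein function `symbol m α`, up to a constant
factor. -/
def levyDensity (m α t : ℝ) : ℝ := t ^ (-1 - α / 2) * Real.exp (-(m ^ (2 / α) * t))

theorem measurable_levyDensity (m α : ℝ) : Measurable (levyDensity m α) := by
  unfold levyDensity
  fun_prop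

theorem levyDensity_pos (m α : ℝ) {t : ℝ} (ht : 0 < t) : 0 < levyDensity m α t := by
  unfold levyDensity
  positivity

/-- The Lévy–Khintchine representation of the symbol: up to the constant `k`, it is the mixture of
the functions `z ↦ 1 - exp (-z t)` with positive weight `levyDensity m α t`. -/
theorem exists_lintegral_levyDensity_eq_symbol {m α : ℝ} (hα₀ : 0 < α) (hα₂ : α < 2)
    (hm : 0 ≤ m) :
    ∃ k : ℝ≥0∞, k ≠ 0 ∧ k ≠ ∞ ∧ ∀ z : ℝ, 0 ≤ z →
      ∫⁻ t in Set.Ioi (0 : ℝ), ENNReal.ofReal (levyDensity m α t) *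
        ENNReal.ofReal (1 - Real.exp (-(z * t))) = k * ENNReal.ofReal (symbol m α z) := by
  obtain ⟨k, hk0, hk, h⟩ := exists_lintegral_one_sub_exp_eq (β := α / 2) (by linarith)
    (by linarith)
  refine ⟨k, hk0, hk, fun z hz => ?_⟩
  have hM : 0 ≤ m ^ (2 / α) := by positivity
  set M := m ^ (2 / α) with hMdef
  have hMm : M ^ (α / 2) = m := by
    rw [hMdef, ← Real.rpow_mul hm, show 2 / α * (α / 2) = 1 by field_simp, Real.rpow_one]
  have hfin : k * ENNReal.ofReal (M ^ (α / 2)) ≠ ∞ := ENNReal.mul_ne_top hk ENNReal.ofReal_ne_top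
  -- adding `k M ^ β`, with `β = α / 2`, gives `k (z + M) ^ β` on both sides
  refine (ENNReal.add_left_inj hfin).1 ?_
  rw [← mul_add, ← ENNReal.ofReal_add (symbol_nonneg hα₀ hm hz) (by positivity)]
  have h3 : symbol m α z + M ^ (α / 2) = (z + M) ^ (α / 2) := by
    rw [symbol, ← hMdef, hMm]; ring
  rw [h3, ← h (z + M) (by positivity), ← h M hM, ← lintegral_add_right _ (by fun_prop)]
  refine setLIntegral_congr_fun measurableSet_Ioi fun t ht => ?_
  have ht : 0 < t := ht
  have e1 : 0 ≤ 1 - Real.exp (-(z * t)) := by simp; positivity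
  have e2 : 0 ≤ 1 - Real.exp (-(M * t)) := by simp; positivity
  rw [← ENNReal.ofReal_mul (levyDensity_pos m α ht).le, ← ENNReal.ofReal_add]
  · congr 1
    rw [levyDensity, ← hMdef, show -((z + M) * t) = -(M * t) + -(z * t) by ring, Real.exp_add]
    ring
  · have := levyDensity_pos m α ht
    positivity
  · positivity

/-! ### The Gaussian pair measure -/

variable {d : ℕ}

/-- The Gaussian density whose Fourier transform is `ξ ↦ exp (-b |ξ|²)`; for `b = (2π)² t` it is the
heat kernel at time `t`. -/
def heatKernel (d : ℕ) (b : ℝ) (x : EuclideanSpace ℝ (Fin d)) : ℝ :=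
  (Real.pi / b) ^ ((d : ℝ) / 2) * Real.exp (-Real.pi ^ 2 * ‖x‖ ^ 2 / b)

theorem heatKernel_pos {b : ℝ} (hb : 0 < b) (x : EuclideanSpace ℝ (Fin d)) :
    0 < heatKernel d b x := by
  unfold heatKernel; positivity

theorem continuous_heatKernel (b : ℝ) : Continuous (heatKernel d b) := by
  unfold heatKernel; fun_prop

theorem lintegral_heatKernel {b : ℝ} (hb : 0 < b) :
    ∫⁻ x, ENNReal.ofReal (heatKernel d b x) = 1 := by
  have hb' : 0 < Real.pi ^ 2 / b := by positivity
  have hexp : ∀ x : EuclideanSpace ℝ (Fin d), Real.exp (-Real.pi ^ 2 * ‖x‖ ^ 2 / b) =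
      Real.exp (-(Real.pi ^ 2 / b) * ‖x‖ ^ 2) := fun x => by congr 1; ring
  have h1 : ∫ x, heatKernel d b x = 1 := by
    simp only [heatKernel, hexp]
    rw [integral_const_mul, GaussianFourier.integral_rexp_neg_mul_sq_norm hb',
      finrank_euclideanSpace_fin, ← Real.mul_rpow (by positivity) (by positivity)]
    have : Real.pi / b * (Real.pi / (Real.pi ^ 2 / b)) = 1 := by
      have := Real.pi_ne_zero
      field_simp
    rw [this, Real.one_rpow]
  have hint : Integrable (heatKernel d b) := by
    by_contra h
    rw [integral_undef h] at h1
    exact zero_ne_one h1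
  rw [← ofReal_integral_eq_lintegral_ofReal hint (ae_of_all _ fun x => (heatKernel_pos hb x).le),
    h1, ENNReal.ofReal_one]

/-- The measure `p(x - y) dx dy`, with `p` the Gaussian density `heatKernel d b`. Both marginals are
Lebesgue measure. -/
def heatPair (d : ℕ) (b : ℝ) : Measure (EuclideanSpace ℝ (Fin d) × EuclideanSpace ℝ (Fin d)) :=
  (volume.prod volume).withDensity fun p => ENNReal.ofReal (heatKernel d b (p.1 - p.2))

theorem measurable_heatKernel_sub (b : ℝ) :
    Measurable fun p : EuclideanSpace ℝ (Fin d) × EuclideanSpace ℝ (Fin d) =>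
      ENNReal.ofReal (heatKernel d b (p.1 - p.2)) :=
  (((continuous_heatKernel b).comp (continuous_fst.sub continuous_snd)).measurable).ennreal_ofReal

theorem heatKernel_comm (b : ℝ) (x y : EuclideanSpace ℝ (Fin d)) :
    heatKernel d b (x - y) = heatKernel d b (y - x) := by
  rw [heatKernel, heatKernel, norm_sub_rev]

theorem measurePreserving_fst_heatPair {b : ℝ} (hb : 0 < b) :
    MeasurePreserving Prod.fst (heatPair d b) volume := by
  refine ⟨measurable_fst, Measure.ext fun A hA => ?_⟩
  rw [Measure.map_apply measurable_fst hA, heatPair, withDensity_apply _ (measurable_fst hA),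
    show (Prod.fst ⁻¹' A : Set (EuclideanSpace ℝ (Fin d) × EuclideanSpace ℝ (Fin d))) =
      A ×ˢ Set.univ by ext; simp, ← Measure.prod_restrict, Measure.restrict_univ,
    lintegral_prod _ (measurable_heatKernel_sub b).aemeasurable]
  simp only
  simp_rw [lintegral_sub_left_eq_self (fun z => ENNReal.ofReal (heatKernel d b z)),
    lintegral_heatKernel hb]
  simp

theorem measurePreserving_swap_heatPair (b : ℝ) :
    MeasurePreserving Prod.swap (heatPair d b) (heatPair d b) := by
  refine ⟨measurable_swap, Measure.ext fun A hA => ?_⟩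
  rw [Measure.map_apply measurable_swap hA, heatPair, withDensity_apply _ (measurable_swap hA),
    withDensity_apply _ hA, ← (Measure.measurePreserving_swap
      (μ := (volume : Measure (EuclideanSpace ℝ (Fin d))))
      (ν := (volume : Measure (EuclideanSpace ℝ (Fin d))))).setLIntegral_comp_preimage hA
      (measurable_heatKernel_sub b)]
  simp only [Prod.fst_swap, Prod.snd_swap]
  simp_rw [heatKernel_comm b]

theorem measurePreserving_snd_heatPair {b : ℝ} (hb : 0 < b) :
    MeasurePreserving Prod.snd (heatPair d b) volume :=
  (measurePreserving_fst_heatPair hb).comp (measurePreserving_swap_heatPair b)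

theorem measurePreserving_prodMap_heatPair (b : ℝ)
    (R : EuclideanSpace ℝ (Fin d) ≃ₗᵢ[ℝ] EuclideanSpace ℝ (Fin d)) :
    MeasurePreserving (Prod.map R R) (heatPair d b) (heatPair d b) := by
  have hR : Measurable (Prod.map R R) :=
    R.continuous.measurable.prodMap R.continuous.measurable
  have hRR : MeasurePreserving (Prod.map R R) (volume.prod volume) (volume.prod volume) :=
    R.measurePreserving.prod R.measurePreserving
  refine ⟨hR, Measure.ext fun A hA => ?_⟩
  rw [Measure.map_apply hR hA, heatPair, withDensity_apply _ (hR hA),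
    withDensity_apply _ hA, ← hRR.setLIntegral_comp_preimage hA (measurable_heatKernel_sub b)]
  refine lintegral_congr fun p => ?_
  simp [heatKernel, ← map_sub]

theorem prod_absolutelyContinuous_heatPair {b : ℝ} (hb : 0 < b) :
    (volume.prod volume : Measure (EuclideanSpace ℝ (Fin d) × EuclideanSpace ℝ (Fin d))) ≪
      heatPair d b :=
  withDensity_absolutelyContinuous' (measurable_heatKernel_sub b).aemeasurable
    (ae_of_all _ fun p => by simpa using heatKernel_pos hb _)

/-- The form `∬ p(x - y) conj (f x) (f y) dx dy` on `L²(ℝᵈ)`, as the inner product of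
`(x, y) ↦ f x` and `(x, y) ↦ f y` in `L²` of the pair measure. As the projections preserve measure,
it is defined and continuous on all of `L²(ℝᵈ)`. -/
def heatForm {b : ℝ} (hb : 0 < b) (f : L2 d) : ℂ :=
  ⟪Lp.compMeasurePreserving Prod.fst (measurePreserving_fst_heatPair hb) f,
    Lp.compMeasurePreserving Prod.snd (measurePreserving_snd_heatPair hb) f⟫_ℂ

theorem continuous_heatForm {b : ℝ} (hb : 0 < b) : Continuous (heatForm (d := d) hb) :=
  (Lp.isometry_compMeasurePreserving _).continuous.inner
    (Lp.isometry_compMeasurePreserving _).continuous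

theorem heatForm_re_le {b : ℝ} (hb : 0 < b) (f : L2 d) : (heatForm hb f).re ≤ ‖f‖ ^ 2 := by
  refine (Complex.re_le_norm _).trans ((norm_inner_le_norm _ _).trans ?_)
  rw [Lp.norm_compMeasurePreserving, Lp.norm_compMeasurePreserving, sq]

theorem heatForm_ae {b : ℝ} (hb : 0 < b) {f : L2 d} {g : EuclideanSpace ℝ (Fin d) → ℂ}
    (h : f =ᵐ[volume] g) : ∀ᵐ p ∂heatPair d b,
      ⟪Lp.compMeasurePreserving Prod.fst (measurePreserving_fst_heatPair hb) f p,
      Lp.compMeasurePreserving Prod.snd (measurePreserving_snd_heatPair hb) f p⟫_ℂ =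
      conj (g p.1) * g p.2 := by
  filter_upwards [Lp.coeFn_compMeasurePreserving f (measurePreserving_fst_heatPair hb),
    Lp.coeFn_compMeasurePreserving f (measurePreserving_snd_heatPair hb),
    (measurePreserving_fst_heatPair hb).quasiMeasurePreserving.ae_eq h,
    (measurePreserving_snd_heatPair hb).quasiMeasurePreserving.ae_eq h] with p h1 h2 h3 h4
  rw [h1, h2, h3, h4, RCLike.inner_apply']
  rfl

theorem integrable_heatForm {b : ℝ} (hb : 0 < b) {f : L2 d} {g : EuclideanSpace ℝ (Fin d) → ℂ}
    (h : f =ᵐ[volume] g) : Integrable (fun p => conj (g p.1) * g p.2) (heatPair d b) :=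
  (L2.integrable_inner (𝕜 := ℂ) _ _).congr (heatForm_ae hb h)

theorem heatForm_eq_integral {b : ℝ} (hb : 0 < b) {f : L2 d} {g : EuclideanSpace ℝ (Fin d) → ℂ}
    (h : f =ᵐ[volume] g) : heatForm hb f = ∫ p, conj (g p.1) * g p.2 ∂heatPair d b := by
  rw [heatForm, L2.inner_def]
  exact integral_congr_ae (heatForm_ae hb h)

theorem heatForm_eq_of_ae_eq_comp {b : ℝ} (hb : 0 < b) {f g : L2 d}
    (R : EuclideanSpace ℝ (Fin d) ≃ₗᵢ[ℝ] EuclideanSpace ℝ (Fin d))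
    (h : g =ᵐ[volume] f ∘ R) : heatForm hb g = heatForm hb f := by
  rw [heatForm_eq_integral hb h, heatForm_eq_integral hb (Filter.EventuallyEq.refl _ f),
    ← (measurePreserving_prodMap_heatPair b R).integral_comp
      (R.toMeasurableEquiv.prodCongr R.toMeasurableEquiv).measurableEmbedding
      (fun p => conj (f p.1) * f p.2)]
  rfl

/-- Positivity of the Gaussian kernel: replacing `f` by `|f|` does not decrease the heat form. -/
theorem heatForm_re_le_of_ae_eq_norm {b : ℝ} (hb : 0 < b) {f g : L2 d}
    (h : g =ᵐ[volume] fun x => (‖f x‖ : ℂ)) : (heatForm hb f).re ≤ (heatForm hb g).re := by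
  rw [heatForm_eq_integral hb h, heatForm_eq_integral hb (Filter.EventuallyEq.refl _ f)]
  have h1 := integrable_heatForm hb h
  have h2 := integrable_heatForm hb (Filter.EventuallyEq.refl _ f)
  have e1 := integral_re h1
  have e2 := integral_re h2
  simp only [RCLike.re_to_complex] at e1 e2
  rw [← e1, ← e2]
  refine integral_mono h2.re h1.re fun p => ?_
  refine (Complex.re_le_norm _).trans (le_of_eq ?_)
  simp only [norm_mul, RCLike.norm_conj, Complex.conj_ofReal]
  norm_cast

/-- Strict positivity of the Gaussian kernel: if `f` and `|f|` have the same heat form, then `f` has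
a constant phase. -/
theorem ae_eq_norm_of_heatForm_re_eq {b : ℝ} (hb : 0 < b) {f g : L2 d}
    (h : g =ᵐ[volume] fun x => (‖f x‖ : ℂ)) (he : (heatForm hb f).re = (heatForm hb g).re) :
    ∀ᵐ x, ∀ᵐ y, conj (f x) * f y = (‖f x‖ * ‖f y‖ : ℂ) := by
  rw [heatForm_eq_integral hb h, heatForm_eq_integral hb (Filter.EventuallyEq.refl _ f)] at he
  have h1 := integrable_heatForm hb h
  have h2 := integrable_heatForm hb (Filter.EventuallyEq.refl _ f)
  have e1 := integral_re h1
  have e2 := integral_re h2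
  simp only [RCLike.re_to_complex] at e1 e2
  have hle : ∀ p : EuclideanSpace ℝ (Fin d) × EuclideanSpace ℝ (Fin d),
      (conj (f p.1) * f p.2).re ≤ (conj (‖f p.1‖ : ℂ) * (‖f p.2‖ : ℂ)).re := fun p => by
    refine (Complex.re_le_norm _).trans (le_of_eq ?_)
    simp only [norm_mul, RCLike.norm_conj, Complex.conj_ofReal]
    norm_cast
  rw [← e1, ← e2] at he
  have hp := (prod_absolutelyContinuous_heatPair hb).ae_le
    ((integral_eq_iff_of_ae_le h2.re h1.re (ae_of_all _ hle)).1 he)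
  have := Measure.ae_ae_of_ae_prod hp
  filter_upwards [this] with x hx
  filter_upwards [hx] with y hy
  have hn : ‖conj (f x) * f y‖ = ‖f x‖ * ‖f y‖ := by rw [norm_mul, RCLike.norm_conj]
  simp only [RCLike.re_to_complex, Complex.conj_ofReal] at hy
  have hr : (conj (f x) * f y).re = ‖conj (f x) * f y‖ := by
    rw [hn, hy]; norm_cast
  rw [Complex.re_eq_norm] at hr
  rw [Complex.eq_coe_norm_of_nonneg hr, hn]
  push_cast; rfl

/-! ### The heat form as a Fourier multiplier -/

theorem integral_fourier_mul_eq_flip {V : Type*} [NormedAddCommGroup V] [InnerProductSpace ℝ V]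
    [MeasurableSpace V] [BorelSpace V] [FiniteDimensional ℝ V] {f g : V → ℂ}
    (hf : Integrable f) (hg : Integrable g) :
    ∫ ξ, 𝓕 f ξ * g ξ = ∫ x, f x * 𝓕 g x := by
  simpa using! VectorFourier.integral_fourierIntegral_smul_eq_flip (L := innerₗ V)
    Real.continuous_fourierChar continuous_inner hf hg

theorem integrable_exp_neg_mul_sq_norm {b : ℝ} (hb : 0 < b) :
    Integrable fun ξ : EuclideanSpace ℝ (Fin d) => (Real.exp (-b * ‖ξ‖ ^ 2) : ℂ) := by
  have := GaussianFourier.integrable_cexp_neg_mul_sq_norm_add (V := EuclideanSpace ℝ (Fin d))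
    (b := (b : ℂ)) (by simpa using hb) 0 0
  refine this.congr (ae_of_all _ fun ξ => ?_)
  push_cast
  simp

theorem fourier_exp_mul_char {b : ℝ} (hb : 0 < b) (y x : EuclideanSpace ℝ (Fin d)) :
    𝓕 (fun ξ : EuclideanSpace ℝ (Fin d) => (Real.exp (-b * ‖ξ‖ ^ 2) : ℂ) *
      Complex.exp (2 * Real.pi * Complex.I * (inner ℝ y ξ : ℝ))) x =
      (heatKernel d b (x - y) : ℂ) := by
  have h := fourier_gaussian_innerProductSpace' (V := EuclideanSpace ℝ (Fin d)) (b := (b : ℂ))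
    (by simpa using hb) y x
  rw [show (fun ξ : EuclideanSpace ℝ (Fin d) => (Real.exp (-b * ‖ξ‖ ^ 2) : ℂ) *
      Complex.exp (2 * Real.pi * Complex.I * (inner ℝ y ξ : ℝ))) = fun ξ =>
      Complex.exp (-(b : ℂ) * ‖ξ‖ ^ 2 + 2 * Real.pi * Complex.I * (inner ℝ y ξ : ℝ)) by
    ext ξ; rw [Complex.exp_add]; push_cast; rfl, h, heatKernel_comm, heatKernel,
    finrank_euclideanSpace_fin]
  push_cast
  rw [Complex.ofReal_cpow (by positivity)]
  push_cast
  rfl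

theorem fourier_gaussian_mul_conj_fourier {b : ℝ} (hb : 0 < b) (f : 𝓢(EuclideanSpace ℝ (Fin d), ℂ))
    (y : EuclideanSpace ℝ (Fin d)) :
    𝓕 (fun ξ : EuclideanSpace ℝ (Fin d) => (Real.exp (-b * ‖ξ‖ ^ 2) : ℂ) *
      conj (𝓕 (f : EuclideanSpace ℝ (Fin d) → ℂ) ξ)) y =
      ∫ x, (heatKernel d b (x - y) : ℂ) * conj (f x) := by
  have hg : Integrable fun ξ : EuclideanSpace ℝ (Fin d) => (Real.exp (-b * ‖ξ‖ ^ 2) : ℂ) *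
      Complex.exp (2 * Real.pi * Complex.I * (inner ℝ y ξ : ℝ)) := by
    refine (integrable_exp_neg_mul_sq_norm hb).mul_bdd (c := 1) (by fun_prop)
      (ae_of_all _ fun ξ => ?_)
    rw [show 2 * (Real.pi : ℂ) * Complex.I * (inner ℝ y ξ : ℝ) =
      ((2 * Real.pi * inner ℝ y ξ : ℝ) : ℂ) * Complex.I by push_cast; ring,
      Complex.norm_exp_ofReal_mul_I]
  have h := congrArg conj (integral_fourier_mul_eq_flip (f.integrable) hg)
  rw [← integral_conj, ← integral_conj] at h
  rw [Real.fourier_eq']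
  simp_rw [fourier_exp_mul_char hb, map_mul, Complex.conj_ofReal] at h
  simp_rw [mul_comm ((heatKernel d b _ : ℝ) : ℂ)]
  rw [← h]
  refine integral_congr_ae (ae_of_all _ fun ξ => ?_)
  simp only [smul_eq_mul]
  rw [← Complex.exp_conj, show conj (2 * (Real.pi : ℂ) * Complex.I * (inner ℝ y ξ : ℝ)) =
    ((-2 * Real.pi * inner ℝ ξ y : ℝ) : ℂ) * Complex.I by
      simp only [map_mul, Complex.conj_ofReal, Complex.conj_I, map_ofNat]
      rw [real_inner_comm]; push_cast; ring]
  ring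

theorem integral_gaussian_mul_norm_fourier_sq_schwartz {b : ℝ} (hb : 0 < b)
    (f : 𝓢(EuclideanSpace ℝ (Fin d), ℂ)) :
    ∫ ξ, (Real.exp (-b * ‖ξ‖ ^ 2) : ℂ) * (conj (𝓕 f ξ) * 𝓕 f ξ) =
      heatForm hb (f.toLp 2 volume) := by
  rw [heatForm_eq_integral hb (f.coeFn_toLp 2 volume)]
  have hint := integrable_heatForm hb (f.coeFn_toLp 2 volume)
  rw [heatPair, integrable_withDensity_iff_integrable_smul' (measurable_heatKernel_sub b)
    (ae_of_all _ fun _ => ENNReal.ofReal_lt_top)] at hint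
  rw [heatPair, integral_withDensity_eq_integral_toReal_smul (measurable_heatKernel_sub b)
    (ae_of_all _ fun _ => ENNReal.ofReal_lt_top), integral_prod_symm _ hint]
  have hF : Integrable fun ξ : EuclideanSpace ℝ (Fin d) => (Real.exp (-b * ‖ξ‖ ^ 2) : ℂ) *
      conj (𝓕 (f : EuclideanSpace ℝ (Fin d) → ℂ) ξ) := by
    have h1 : Integrable fun ξ => conj (𝓕 f ξ) :=
      (Complex.conjLIE.toContinuousLinearEquiv.toContinuousLinearMap).integrable_comp
        (𝓕 f).integrable
    have := h1.bdd_mul (c := 1) (f := fun ξ : EuclideanSpace ℝ (Fin d) =>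
      (Real.exp (-b * ‖ξ‖ ^ 2) : ℂ)) (by fun_prop) (ae_of_all _ fun ξ => ?_)
    · simpa only [SchwartzMap.fourier_coe] using this
    · rw [Complex.norm_real, Real.norm_of_nonneg (Real.exp_pos _).le, Real.exp_le_one_iff]
      nlinarith [sq_nonneg ‖ξ‖]
  have h := integral_fourier_mul_eq_flip f.integrable hF
  calc _ = ∫ ξ, 𝓕 (f : EuclideanSpace ℝ (Fin d) → ℂ) ξ * ((Real.exp (-b * ‖ξ‖ ^ 2) : ℂ) *
      conj (𝓕 (f : EuclideanSpace ℝ (Fin d) → ℂ) ξ)) := by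
        refine integral_congr_ae (ae_of_all _ fun ξ => ?_)
        simp only [SchwartzMap.fourier_coe]
        ring
    _ = _ := by
      rw [h]
      refine integral_congr_ae (ae_of_all _ fun y => ?_)
      simp only [fourier_gaussian_mul_conj_fourier hb]
      rw [← integral_const_mul]
      refine integral_congr_ae (ae_of_all _ fun x => ?_)
      simp only [Complex.real_smul, ENNReal.toReal_ofReal (heatKernel_pos hb _).le]
      ring

/-- The function `ξ ↦ exp (-b |ξ|²)` as an element of `L∞`. -/
def gaussianLp (d : ℕ) {b : ℝ} (hb : 0 < b) : Lp (α := EuclideanSpace ℝ (Fin d)) ℂ ∞ volume :=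
  MemLp.toLp (fun ξ => (Real.exp (-b * ‖ξ‖ ^ 2) : ℂ))
    (memLp_top_of_bound (by fun_prop) 1 (ae_of_all _ fun ξ => by
      rw [Complex.norm_real, Real.norm_of_nonneg (Real.exp_pos _).le, Real.exp_le_one_iff]
      nlinarith [sq_nonneg ‖ξ‖]))

/-- Expresses the Gaussian-weighted integral as a continuous function of `g : L²`. -/
theorem inner_gaussianLp_holder {b : ℝ} (hb : 0 < b) {g : L2 d} {h : EuclideanSpace ℝ (Fin d) → ℂ}
    (hgh : g =ᵐ[volume] h) :
    ⟪g, (ContinuousLinearMap.mul ℂ ℂ).holderL volume ∞ 2 2 (gaussianLp d hb) g⟫_ℂ =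
      ∫ ξ, (Real.exp (-b * ‖ξ‖ ^ 2) : ℂ) * (conj (h ξ) * h ξ) := by
  rw [L2.inner_def]
  refine integral_congr_ae ?_
  filter_upwards [(ContinuousLinearMap.mul ℂ ℂ).coeFn_holder (r := 2) (gaussianLp d hb) g,
    MemLp.coeFn_toLp (f := fun ξ : EuclideanSpace ℝ (Fin d) => (Real.exp (-b * ‖ξ‖ ^ 2) : ℂ))
    _, hgh] with ξ h1 h2 h3
  rw [ContinuousLinearMap.holderL_apply_apply, h1, gaussianLp, h2, h3, RCLike.inner_apply']
  simp only [ContinuousLinearMap.mul_apply']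
  ring

/-- On the Fourier side the heat form has the density `exp (-b |ξ|²)`. Both sides are continuous in
`f`, so Schwartz functions suffice. -/
theorem integral_gaussian_mul_norm_fourier_sq {b : ℝ} (hb : 0 < b) (f : L2 d) :
    ∫ ξ, (Real.exp (-b * ‖ξ‖ ^ 2) : ℂ) * (conj (fourierL2 d f ξ) * fourierL2 d f ξ) =
      heatForm hb f := by
  rw [← inner_gaussianLp_holder hb (Filter.EventuallyEq.refl _ _)]
  refine DenseRange.induction_on (p := fun f : L2 d => ⟪fourierL2 d f,
    (ContinuousLinearMap.mul ℂ ℂ).holderL volume ∞ 2 2 (gaussianLp d hb) (fourierL2 d f)⟫_ℂ =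
      heatForm hb f)
    (SchwartzMap.denseRange_toLpCLM (p := 2) ENNReal.ofNat_ne_top) f
    (isClosed_eq ?_ (continuous_heatForm hb)) fun f => ?_
  · exact (fourierL2 d).continuous.inner
      ((ContinuousLinearMap.continuous _).comp (fourierL2 d).continuous)
  · rw [SchwartzMap.toLpCLM_apply, ← integral_gaussian_mul_norm_fourier_sq_schwartz hb f]
    have : fourierL2 d (f.toLp 2 volume) = (𝓕 f).toLp 2 volume := f.toLp_fourier_eq
    rw [this]
    exact inner_gaussianLp_holder hb ((𝓕 f).coeFn_toLp 2 volume)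

/-! ### The energy form of the free operator -/

theorem norm_sq_eq_integral_of_ae_eq {f : L2 d} {g : EuclideanSpace ℝ (Fin d) → ℂ}
    (h : f =ᵐ[volume] g) : ‖f‖ ^ 2 = ∫ x, ‖g x‖ ^ 2 := by
  have h1 : ((‖f‖ ^ 2 : ℝ) : ℂ) = ((∫ x, ‖g x‖ ^ 2 : ℝ) : ℂ) := by
    rw [← integral_complex_ofReal, Complex.ofReal_pow, ← Complex.coe_algebraMap,
      ← inner_self_eq_norm_sq_to_K, L2.inner_def]
    refine integral_congr_ae ?_
    filter_upwards [h] with x hx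
    rw [hx, inner_self_eq_norm_sq_to_K]
    simp
  exact_mod_cast h1

theorem integrable_norm_sq (f : L2 d) : Integrable fun x => ‖f x‖ ^ 2 :=
  (memLp_two_iff_integrable_sq_norm (Lp.aestronglyMeasurable f)).1 (Lp.memLp f)

theorem ofReal_norm_sq_eq (z : ℂ) : ENNReal.ofReal (‖z‖ ^ 2) = ‖z‖ₑ ^ 2 := by
  rw [ENNReal.ofReal_pow (norm_nonneg _), ofReal_norm]

theorem continuous_symbol_comp {m α : ℝ} (hα : 0 < α) :
    Continuous fun ξ : EuclideanSpace ℝ (Fin d) => symbol m α ((2 * Real.pi * ‖ξ‖) ^ 2) := by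
  unfold symbol
  exact ((by fun_prop : Continuous fun ξ : EuclideanSpace ℝ (Fin d) =>
    (2 * Real.pi * ‖ξ‖) ^ 2 + m ^ (2 / α)).rpow_const fun _ => Or.inr (by positivity)).sub
      continuous_const

/-- The quadratic form of `L_{m,α}`, extended by `∞` outside the form domain. -/
def energy (m α : ℝ) (f : L2 d) : ℝ≥0∞ :=
  ∫⁻ ξ, ENNReal.ofReal (symbol m α ((2 * Real.pi * ‖ξ‖) ^ 2)) * ‖fourierL2 d f ξ‖ₑ ^ 2

/-- The form `⟪(1 - exp (tΔ)) f, f⟫`. -/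
def heatDeficit (t : ℝ) (f : L2 d) : ℝ≥0∞ :=
  ∫⁻ ξ, ENNReal.ofReal (1 - Real.exp (-((2 * Real.pi * ‖ξ‖) ^ 2 * t))) * ‖fourierL2 d f ξ‖ₑ ^ 2

theorem measurable_heatDeficit_integrand (f : L2 d) :
    Measurable fun p : ℝ × EuclideanSpace ℝ (Fin d) =>
      ENNReal.ofReal (1 - Real.exp (-((2 * Real.pi * ‖p.2‖) ^ 2 * p.1))) *
        ‖fourierL2 d f p.2‖ₑ ^ 2 := by
  have h := (Lp.stronglyMeasurable (fourierL2 d f)).measurable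
  refine Measurable.mul (f := fun p : ℝ × EuclideanSpace ℝ (Fin d) =>
    ENNReal.ofReal (1 - Real.exp (-((2 * Real.pi * ‖p.2‖) ^ 2 * p.1)))) (by fun_prop) ?_
  exact ((h.comp measurable_snd).enorm).pow_const 2

theorem measurable_heatDeficit (f : L2 d) : Measurable fun t => heatDeficit t f :=
  (measurable_heatDeficit_integrand f).lintegral_prod_right'

theorem mul_pos_four_pi_sq {t : ℝ} (ht : 0 < t) : 0 < (2 * Real.pi) ^ 2 * t := by positivity

theorem heatDeficit_eq {t : ℝ} (ht : 0 < t) (f : L2 d) :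
    heatDeficit t f =
      ENNReal.ofReal (‖f‖ ^ 2 - (heatForm (mul_pos_four_pi_sq ht) f).re) := by
  set b := (2 * Real.pi) ^ 2 * t with hb
  have hbp : 0 < b := mul_pos_four_pi_sq ht
  have hn : ‖f‖ ^ 2 = ∫ ξ, ‖fourierL2 d f ξ‖ ^ 2 := by
    rw [← (fourierL2 d).norm_map f]
    exact norm_sq_eq_integral_of_ae_eq (Filter.EventuallyEq.refl _ _)
  have hle : ∀ ξ : EuclideanSpace ℝ (Fin d), Real.exp (-b * ‖ξ‖ ^ 2) ≤ 1 := fun ξ => by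
    rw [Real.exp_le_one_iff]
    nlinarith [sq_nonneg ‖ξ‖]
  have hint := integrable_norm_sq (fourierL2 d f)
  have hint2 : Integrable fun ξ => Real.exp (-b * ‖ξ‖ ^ 2) * ‖fourierL2 d f ξ‖ ^ 2 :=
    hint.bdd_mul (c := 1) (by fun_prop) (ae_of_all _ fun ξ => by
      rw [Real.norm_of_nonneg (Real.exp_pos _).le]; exact hle ξ)
  have hh : (heatForm hbp f).re = ∫ ξ, Real.exp (-b * ‖ξ‖ ^ 2) * ‖fourierL2 d f ξ‖ ^ 2 := by
    rw [← integral_gaussian_mul_norm_fourier_sq hbp f, ← Complex.ofReal_re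
      (∫ ξ, Real.exp (-b * ‖ξ‖ ^ 2) * ‖fourierL2 d f ξ‖ ^ 2), ← integral_complex_ofReal]
    congr 1
    refine integral_congr_ae (ae_of_all _ fun ξ => ?_)
    simp only
    rw [Complex.conj_mul']
    push_cast
    rfl
  rw [hh, hn, ← integral_sub hint hint2, ofReal_integral_eq_lintegral_ofReal (f := fun ξ =>
      ‖fourierL2 d f ξ‖ ^ 2 - Real.exp (-b * ‖ξ‖ ^ 2) * ‖fourierL2 d f ξ‖ ^ 2) (hint.sub hint2)
    (ae_of_all _ fun ξ => ?_)]
  · refine lintegral_congr fun ξ => ?_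
    rw [← ofReal_norm_sq_eq, ← ENNReal.ofReal_mul]
    · congr 1
      rw [show -((2 * Real.pi * ‖ξ‖) ^ 2 * t) = -b * ‖ξ‖ ^ 2 by rw [hb]; ring]
      ring
    · rw [show -((2 * Real.pi * ‖ξ‖) ^ 2 * t) = -b * ‖ξ‖ ^ 2 by rw [hb]; ring]
      linarith [hle ξ]
  · have := mul_nonneg (sub_nonneg.2 (hle ξ)) (sq_nonneg ‖fourierL2 d f ξ‖)
    simp only [Pi.zero_apply]
    linarith

/-- The energy is a mixture of the forms `⟪(1 - exp (tΔ)) f, f⟫` with positive weights. -/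
theorem exists_mul_energy_eq (d : ℕ) {m α : ℝ} (hα₀ : 0 < α) (hα₂ : α < 2) (hm : 0 ≤ m) :
    ∃ k : ℝ≥0∞, k ≠ 0 ∧ k ≠ ∞ ∧ ∀ f : L2 d, k * energy m α f =
      ∫⁻ t in Set.Ioi (0 : ℝ), ENNReal.ofReal (levyDensity m α t) * heatDeficit t f := by
  obtain ⟨k, hk0, hk, h⟩ := exists_lintegral_levyDensity_eq_symbol hα₀ hα₂ hm
  refine ⟨k, hk0, hk, fun f => ?_⟩
  have hmeas := measurable_heatDeficit_integrand f
  have hw : Measurable fun p : ℝ × EuclideanSpace ℝ (Fin d) =>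
      ENNReal.ofReal (levyDensity m α p.1) :=
    ((measurable_levyDensity m α).comp measurable_fst).ennreal_ofReal
  calc k * energy m α f
      = ∫⁻ ξ, (∫⁻ t in Set.Ioi (0 : ℝ), ENNReal.ofReal (levyDensity m α t) *
        ENNReal.ofReal (1 - Real.exp (-((2 * Real.pi * ‖ξ‖) ^ 2 * t)))) *
          ‖fourierL2 d f ξ‖ₑ ^ 2 := by
        rw [energy, ← lintegral_const_mul' _ _ hk]
        refine lintegral_congr fun ξ => ?_
        rw [h _ (by positivity), ← mul_assoc]
    _ = ∫⁻ ξ, ∫⁻ t in Set.Ioi (0 : ℝ), ENNReal.ofReal (levyDensity m α t) *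
        (ENNReal.ofReal (1 - Real.exp (-((2 * Real.pi * ‖ξ‖) ^ 2 * t))) *
          ‖fourierL2 d f ξ‖ₑ ^ 2) := by
        refine lintegral_congr fun ξ => ?_
        rw [← lintegral_mul_const']
        · simp_rw [mul_assoc]
        · simp
    _ = ∫⁻ t in Set.Ioi (0 : ℝ), ∫⁻ ξ, ENNReal.ofReal (levyDensity m α t) *
        (ENNReal.ofReal (1 - Real.exp (-((2 * Real.pi * ‖ξ‖) ^ 2 * t))) *
          ‖fourierL2 d f ξ‖ₑ ^ 2) :=
        (lintegral_lintegral_swap (hw.mul hmeas).aemeasurable).symm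
    _ = _ := by
        refine lintegral_congr fun t => ?_
        rw [lintegral_const_mul' _ _ ENNReal.ofReal_ne_top, heatDeficit]

theorem norm_eq_of_ae_eq_norm {f g : L2 d} (h : g =ᵐ[volume] fun x => (‖f x‖ : ℂ)) :
    ‖g‖ = ‖f‖ := by
  have h1 : ‖g‖ ^ 2 = ‖f‖ ^ 2 := by
    rw [norm_sq_eq_integral_of_ae_eq h,
      norm_sq_eq_integral_of_ae_eq (Filter.EventuallyEq.refl _ f)]
    simp
  exact (sq_eq_sq₀ (norm_nonneg _) (norm_nonneg _)).1 h1

theorem norm_eq_of_ae_eq_comp {f g : L2 d}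
    (R : EuclideanSpace ℝ (Fin d) ≃ₗᵢ[ℝ] EuclideanSpace ℝ (Fin d))
    (h : g =ᵐ[volume] f ∘ R) : ‖g‖ = ‖f‖ := by
  have : g = Lp.compMeasurePreserving R R.measurePreserving f :=
    Lp.ext (h.trans (Lp.coeFn_compMeasurePreserving f R.measurePreserving).symm)
  rw [this, Lp.norm_compMeasurePreserving]

theorem energy_eq_of_ae_eq_comp {m α : ℝ} (hα₀ : 0 < α) (hα₂ : α < 2) (hm : 0 ≤ m) {f g : L2 d}
    (R : EuclideanSpace ℝ (Fin d) ≃ₗᵢ[ℝ] EuclideanSpace ℝ (Fin d))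
    (h : g =ᵐ[volume] f ∘ R) : energy m α g = energy m α f := by
  obtain ⟨k, hk0, hk, hE⟩ := exists_mul_energy_eq d hα₀ hα₂ hm
  refine (ENNReal.mul_right_inj hk0 hk).1 ?_
  rw [hE, hE]
  refine setLIntegral_congr_fun measurableSet_Ioi fun t ht => ?_
  rw [heatDeficit_eq ht, heatDeficit_eq ht, norm_eq_of_ae_eq_comp R h,
    heatForm_eq_of_ae_eq_comp _ R h]

theorem heatDeficit_le_of_ae_eq_norm {t : ℝ} (ht : 0 < t) {f g : L2 d}
    (h : g =ᵐ[volume] fun x => (‖f x‖ : ℂ)) : heatDeficit t g ≤ heatDeficit t f := by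
  rw [heatDeficit_eq ht, heatDeficit_eq ht, norm_eq_of_ae_eq_norm h]
  exact ENNReal.ofReal_le_ofReal (sub_le_sub_left (heatForm_re_le_of_ae_eq_norm _ h) _)

/-- The first Beurling–Deny criterion: `|f|` has at most the energy of `f`. -/
theorem energy_le_of_ae_eq_norm {m α : ℝ} (hα₀ : 0 < α) (hα₂ : α < 2) (hm : 0 ≤ m) {f g : L2 d}
    (h : g =ᵐ[volume] fun x => (‖f x‖ : ℂ)) : energy m α g ≤ energy m α f := by
  obtain ⟨k, hk0, hk, hE⟩ := exists_mul_energy_eq d hα₀ hα₂ hm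
  refine (ENNReal.mul_le_mul_iff_right hk0 hk).1 ?_
  rw [hE, hE]
  refine setLIntegral_mono_ae' measurableSet_Ioi (ae_of_all _ fun t ht => ?_)
  exact mul_le_mul_right (heatDeficit_le_of_ae_eq_norm ht h) _

/-- Equality in the Beurling–Deny inequality forces `f` to have a constant phase. -/
theorem ae_eq_norm_of_energy_eq {m α : ℝ} (hα₀ : 0 < α) (hα₂ : α < 2) (hm : 0 ≤ m) {f g : L2 d}
    (h : g =ᵐ[volume] fun x => (‖f x‖ : ℂ)) (hfin : energy m α f ≠ ∞)
    (he : energy m α g = energy m α f) :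
    ∀ᵐ x, ∀ᵐ y, conj (f x) * f y = (‖f x‖ * ‖f y‖ : ℂ) := by
  obtain ⟨k, hk0, hk, hE⟩ := exists_mul_energy_eq d hα₀ hα₂ hm
  have hae := ae_eq_of_ae_le_of_lintegral_le (μ := volume.restrict (Set.Ioi (0 : ℝ)))
    (f := fun t => ENNReal.ofReal (levyDensity m α t) * heatDeficit t g)
    (g := fun t => ENNReal.ofReal (levyDensity m α t) * heatDeficit t f)
    ((ae_restrict_iff' measurableSet_Ioi).2 (ae_of_all _ fun t ht =>
      mul_le_mul_right (heatDeficit_le_of_ae_eq_norm ht h) _))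
    (by rw [← hE, he]; exact ENNReal.mul_ne_top hk hfin)
    ((measurable_levyDensity m α).ennreal_ofReal.mul (measurable_heatDeficit f)).aemeasurable
    (by rw [← hE, ← hE, he])
  have : (ae (volume.restrict (Set.Ioi (0 : ℝ)))).NeBot := by
    rw [ae_neBot]
    intro h0
    have := congrArg (fun μ : Measure ℝ => μ Set.univ) h0
    simp at this
  -- the heat deficits agree at almost every time; a single positive time is enough
  obtain ⟨t, hte, ht⟩ := (hae.and (ae_restrict_mem measurableSet_Ioi)).exists
  have ht0 : 0 < t := ht
  have h1 := (ENNReal.mul_right_inj (by simpa using levyDensity_pos m α ht0)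
    ENNReal.ofReal_ne_top).1 hte
  rw [heatDeficit_eq ht0, heatDeficit_eq ht0, norm_eq_of_ae_eq_norm h,
    ENNReal.ofReal_eq_ofReal_iff (sub_nonneg.2 (norm_eq_of_ae_eq_norm h ▸ heatForm_re_le _ g))
      (sub_nonneg.2 (heatForm_re_le _ f))] at h1
  exact ae_eq_norm_of_heatForm_re_eq _ h (by linarith)

theorem enorm_add_sq_add_enorm_sub_sq (a b : ℂ) :
    ‖a + b‖ₑ ^ 2 + ‖a - b‖ₑ ^ 2 = 2 * (‖a‖ₑ ^ 2 + ‖b‖ₑ ^ 2) := by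
  have := parallelogram_law_with_norm ℝ a b
  simp_rw [← ofReal_norm_sq_eq]
  rw [← ENNReal.ofReal_add (by positivity) (by positivity),
    ← ENNReal.ofReal_add (by positivity) (by positivity),
    show (2 : ℝ≥0∞) = ENNReal.ofReal 2 by simp, ← ENNReal.ofReal_mul (by positivity)]
  rw [this]

theorem energy_add_add_energy_sub {m α : ℝ} (hα : 0 < α) (f g : L2 d) :
    energy m α (f + g) + energy m α (f - g) = 2 * (energy m α f + energy m α g) := by
  have hw : Measurable fun ξ : EuclideanSpace ℝ (Fin d) =>
      ENNReal.ofReal (symbol m α ((2 * Real.pi * ‖ξ‖) ^ 2)) :=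
    (continuous_symbol_comp hα).measurable.ennreal_ofReal
  have hM : ∀ u : L2 d, Measurable fun ξ : EuclideanSpace ℝ (Fin d) =>
      ENNReal.ofReal (symbol m α ((2 * Real.pi * ‖ξ‖) ^ 2)) * ‖u ξ‖ₑ ^ 2 := fun u =>
    hw.mul ((Lp.stronglyMeasurable u).measurable.enorm.pow_const 2)
  unfold energy
  rw [← lintegral_add_left (hM _), ← lintegral_add_left (hM _),
    ← lintegral_const_mul 2 (f := fun ξ =>
      ENNReal.ofReal (symbol m α ((2 * Real.pi * ‖ξ‖) ^ 2)) * ‖fourierL2 d f ξ‖ₑ ^ 2 +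
      ENNReal.ofReal (symbol m α ((2 * Real.pi * ‖ξ‖) ^ 2)) * ‖fourierL2 d g ξ‖ₑ ^ 2)
    ((hM _).add (hM _))]
  refine lintegral_congr_ae ?_
  rw [map_add, map_sub]
  filter_upwards [Lp.coeFn_add (fourierL2 d f) (fourierL2 d g),
    Lp.coeFn_sub (fourierL2 d f) (fourierL2 d g)] with ξ h1 h2
  rw [h1, h2, Pi.add_apply, Pi.sub_apply, ← mul_add, enorm_add_sq_add_enorm_sub_sq]
  ring

/-! ### The quadratic form of the operator with a well -/

theorem coeFn_indicatorMul {K : Set (EuclideanSpace ℝ (Fin d))} (hK : MeasurableSet K) (f : L2 d) :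
    indicatorMul hK f =ᵐ[volume] K.indicator f := by
  have h : indicatorMul hK f = ((Lp.memLp f).indicator hK).toLp (K.indicator f) := rfl
  rw [h]
  exact MemLp.coeFn_toLp _

theorem norm_indicatorMul_le {K : Set (EuclideanSpace ℝ (Fin d))} (hK : MeasurableSet K)
    (f : L2 d) : ‖indicatorMul hK f‖ ≤ ‖f‖ := by
  refine Lp.norm_le_norm_of_ae_le ?_
  filter_upwards [coeFn_indicatorMul hK f] with x hx
  rw [hx]
  exact norm_indicator_le_norm_self _ _

theorem continuous_indicatorMul {K : Set (EuclideanSpace ℝ (Fin d))} (hK : MeasurableSet K) :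
    Continuous (indicatorMul (d := d) hK) :=
  ((indicatorMul hK).mkContinuous 1 fun f => by
    rw [one_mul]; exact norm_indicatorMul_le hK f).continuous

theorem inner_indicatorMul_left {K : Set (EuclideanSpace ℝ (Fin d))} (hK : MeasurableSet K)
    (f g : L2 d) : ⟪indicatorMul hK f, g⟫_ℂ = ⟪f, indicatorMul hK g⟫_ℂ := by
  rw [L2.inner_def, L2.inner_def]
  refine integral_congr_ae ?_
  filter_upwards [coeFn_indicatorMul hK f, coeFn_indicatorMul hK g] with x h1 h2
  rw [h1, h2]
  by_cases hx : x ∈ K <;> simp [hx]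

theorem inner_indicatorMul_self {K : Set (EuclideanSpace ℝ (Fin d))} (hK : MeasurableSet K)
    (f : L2 d) : ⟪indicatorMul hK f, f⟫_ℂ = ((‖indicatorMul hK f‖ ^ 2 : ℝ) : ℂ) := by
  have h : indicatorMul hK (indicatorMul hK f) = indicatorMul hK f := by
    refine Lp.ext ?_
    filter_upwards [coeFn_indicatorMul hK (indicatorMul hK f), coeFn_indicatorMul hK f]
      with x h1 h2
    rw [h1]
    by_cases hx : x ∈ K
    · simp [hx]
    · rw [h2]; simp [hx]
  conv_lhs => rw [← h, inner_indicatorMul_left, inner_self_eq_norm_sq_to_K]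
  norm_cast

theorem inner_fourierL2_symm_left (f g : L2 d) :
    ⟪(fourierL2 d).symm f, g⟫_ℂ = ⟪f, fourierL2 d g⟫_ℂ := by
  rw [← (fourierL2 d).inner_map_map, LinearIsometryEquiv.apply_symm_apply]

theorem inner_freeOp_left {m α : ℝ} (f : (freeOp d m α).domain) (g : L2 d) :
    ⟪freeOp d m α f, g⟫_ℂ = ∫ ξ, (symbol m α ((2 * Real.pi * ‖ξ‖) ^ 2) : ℂ) *
      (conj (fourierL2 d f ξ) * fourierL2 d g ξ) := by
  have h1 : freeOp d m α f = (fourierL2 d).symm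
      (mulOp (multiplier d m α) ⟨fourierL2 d f, f.2⟩) := rfl
  have h2 : mulOp (multiplier d m α) ⟨fourierL2 d f, f.2⟩ =ᵐ[volume]
      fun ξ => multiplier d m α ξ * fourierL2 d f ξ :=
    MemLp.coeFn_toLp (mulDomain_memLp (⟨fourierL2 d f, f.2⟩ : mulDomain (multiplier d m α)))
  rw [h1, inner_fourierL2_symm_left, L2.inner_def]
  refine integral_congr_ae ?_
  filter_upwards [h2] with ξ hξ
  rw [hξ, RCLike.inner_apply', map_mul, multiplier, Complex.conj_ofReal, mul_assoc]

theorem freeOp_symm {m α : ℝ} (f g : (freeOp d m α).domain) :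
    ⟪freeOp d m α f, (g : L2 d)⟫_ℂ = ⟪(f : L2 d), freeOp d m α g⟫_ℂ := by
  rw [← inner_conj_symm (f : L2 d), inner_freeOp_left, inner_freeOp_left, ← integral_conj]
  refine integral_congr_ae (ae_of_all _ fun ξ => ?_)
  simp only [map_mul, Complex.conj_ofReal, Complex.conj_conj]
  ring

theorem inner_freeOp_self {m α : ℝ} (hα : 0 < α) (hm : 0 ≤ m) (f : (freeOp d m α).domain) :
    energy m α (f : L2 d) ≠ ∞ ∧
      ⟪freeOp d m α f, (f : L2 d)⟫_ℂ = ((energy m α (f : L2 d)).toReal : ℂ) := by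
  have hnn : ∀ ξ : EuclideanSpace ℝ (Fin d), 0 ≤ symbol m α ((2 * Real.pi * ‖ξ‖) ^ 2) *
      ‖fourierL2 d f ξ‖ ^ 2 := fun ξ =>
    mul_nonneg (symbol_nonneg hα hm (by positivity)) (sq_nonneg _)
  have hpt : ∀ ξ, (symbol m α ((2 * Real.pi * ‖ξ‖) ^ 2) : ℂ) *
      (conj (fourierL2 d f ξ) * fourierL2 d f ξ) =
      ((symbol m α ((2 * Real.pi * ‖ξ‖) ^ 2) * ‖fourierL2 d f ξ‖ ^ 2 : ℝ) : ℂ) := fun ξ => by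
    rw [Complex.conj_mul']; push_cast; rfl
  have hint : Integrable fun ξ => symbol m α ((2 * Real.pi * ‖ξ‖) ^ 2) *
      ‖fourierL2 d f ξ‖ ^ 2 := by
    have h2 : MemLp (fun ξ => multiplier d m α ξ * fourierL2 d f ξ) 2 volume := f.2
    have h3 := (h2.norm.integrable_mul (Lp.memLp (fourierL2 d f)).norm)
    refine h3.congr (ae_of_all _ fun ξ => ?_)
    simp only [Pi.mul_apply, norm_mul, multiplier, Complex.norm_real]
    rw [Real.norm_of_nonneg (symbol_nonneg hα hm (by positivity))]
    ring
  have he : energy m α (f : L2 d) = ENNReal.ofReal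
      (∫ ξ, symbol m α ((2 * Real.pi * ‖ξ‖) ^ 2) * ‖fourierL2 d f ξ‖ ^ 2) := by
    rw [ofReal_integral_eq_lintegral_ofReal hint (ae_of_all _ hnn), energy]
    refine lintegral_congr fun ξ => ?_
    rw [← ofReal_norm_sq_eq, ENNReal.ofReal_mul (symbol_nonneg hα hm (by positivity))]
  refine ⟨he ▸ ENNReal.ofReal_ne_top, ?_⟩
  rw [inner_freeOp_left, he, ENNReal.toReal_ofReal (integral_nonneg hnn), ← integral_complex_ofReal]
  exact integral_congr_ae (ae_of_all _ hpt)

theorem wellOp_apply {m α v : ℝ} {K : Set (EuclideanSpace ℝ (Fin d))} (hK : MeasurableSet K)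
    (f : (wellOp m α v hK).domain) :
    wellOp m α v hK f = freeOp d m α f - (v : ℂ) • indicatorMul hK (f : L2 d) := rfl

theorem wellOp_symm {m α v : ℝ} {K : Set (EuclideanSpace ℝ (Fin d))} (hK : MeasurableSet K)
    (f g : (wellOp m α v hK).domain) :
    ⟪wellOp m α v hK f, (g : L2 d)⟫_ℂ = ⟪(f : L2 d), wellOp m α v hK g⟫_ℂ := by
  rw [wellOp_apply, wellOp_apply, inner_sub_left, inner_sub_right, inner_smul_left,
    inner_smul_right, inner_indicatorMul_left, Complex.conj_ofReal]
  exact congrArg (· - _) (freeOp_symm f g)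

theorem re_inner_wellOp_self {m α v : ℝ} (hα : 0 < α) (hm : 0 ≤ m)
    {K : Set (EuclideanSpace ℝ (Fin d))} (hK : MeasurableSet K) (f : (wellOp m α v hK).domain) :
    (⟪wellOp m α v hK f, (f : L2 d)⟫_ℂ).re =
      (energy m α (f : L2 d)).toReal - v * ‖indicatorMul hK (f : L2 d)‖ ^ 2 := by
  have h := (inner_freeOp_self hα hm f).2
  rw [wellOp_apply, inner_sub_left, inner_smul_left, inner_indicatorMul_self, Complex.conj_ofReal,
    Complex.sub_re, ← Complex.ofReal_mul, Complex.ofReal_re]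
  rw [h, Complex.ofReal_re]

/-- The restriction of `f` to the frequencies in the closed ball of radius `n`. -/
def fourierTruncate (n : ℕ) (f : L2 d) : L2 d :=
  (fourierL2 d).symm (indicatorMul (measurableSet_closedBall (x := 0) (ε := (n : ℝ)))
    (fourierL2 d f))

theorem coeFn_fourierL2_fourierTruncate (n : ℕ) (f : L2 d) :
    fourierL2 d (fourierTruncate n f) =ᵐ[volume]
      (Metric.closedBall 0 (n : ℝ)).indicator (fourierL2 d f) := by
  rw [fourierTruncate, LinearIsometryEquiv.apply_symm_apply]
  exact coeFn_indicatorMul _ _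

theorem fourierTruncate_mem_domain {m α : ℝ} (hα : 0 < α) (n : ℕ) (f : L2 d) :
    fourierTruncate n f ∈ (freeOp d m α).domain := by
  change MemLp (fun ξ => multiplier d m α ξ * fourierL2 d (fourierTruncate n f) ξ) 2 volume
  have hcont : Continuous (multiplier d m α) :=
    Complex.continuous_ofReal.comp (continuous_symbol_comp hα)
  obtain ⟨C, hC⟩ := (isCompact_closedBall (0 : EuclideanSpace ℝ (Fin d))
    (n : ℝ)).exists_bound_of_continuousOn
    hcont.continuousOn
  refine (Lp.memLp (fourierL2 d f)).of_le_mul (c := C)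
    (hcont.aestronglyMeasurable.mul (Lp.aestronglyMeasurable _)) ?_
  filter_upwards [coeFn_fourierL2_fourierTruncate n f] with ξ hξ
  rw [hξ]
  by_cases h : ξ ∈ Metric.closedBall 0 (n : ℝ)
  · rw [Set.indicator_of_mem h, norm_mul]
    exact mul_le_mul_of_nonneg_right (hC ξ h) (norm_nonneg _)
  · rw [Set.indicator_of_notMem h, mul_zero, norm_zero]
    have h0 := (norm_nonneg _).trans (hC 0 (Metric.mem_closedBall_self (Nat.cast_nonneg n)))
    exact mul_nonneg h0 (norm_nonneg _)

theorem energy_fourierTruncate_le (m α : ℝ) (n : ℕ) (f : L2 d) :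
    energy m α (fourierTruncate n f) ≤ energy m α f := by
  refine lintegral_mono_ae ?_
  filter_upwards [coeFn_fourierL2_fourierTruncate n f] with ξ hξ
  rw [hξ]
  gcongr
  exact enorm_indicator_le_enorm_self _ _

theorem tendsto_fourierTruncate (f : L2 d) :
    Filter.Tendsto (fun n => fourierTruncate n f) Filter.atTop (nhds f) := by
  rw [tendsto_iff_norm_sub_tendsto_zero]
  have h1 : ∀ n : ℕ, ‖fourierTruncate n f - f‖ = √ (∫ ξ,
      ‖(Metric.closedBall 0 (n : ℝ)).indicator (fourierL2 d f) ξ - fourierL2 d f ξ‖ ^ 2) := by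
    intro n
    rw [← (fourierL2 d).norm_map,
      ← norm_sq_eq_integral_of_ae_eq (f := fourierL2 d (fourierTruncate n f - f)),
      Real.sqrt_sq (norm_nonneg _)]
    rw [map_sub]
    filter_upwards [Lp.coeFn_sub (fourierL2 d (fourierTruncate n f)) (fourierL2 d f),
      coeFn_fourierL2_fourierTruncate n f] with ξ h2 h3
    rw [h2, Pi.sub_apply, h3]
  simp_rw [h1]
  rw [← Real.sqrt_zero]
  refine (Real.continuous_sqrt.tendsto 0).comp ?_
  rw [← integral_zero (EuclideanSpace ℝ (Fin d)) ℝ (μ := volume)]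
  refine tendsto_integral_of_dominated_convergence (fun ξ => ‖fourierL2 d f ξ‖ ^ 2)
    (fun n => ?_) (integrable_norm_sq _) (fun n => ae_of_all _ fun ξ => ?_)
    (ae_of_all _ fun ξ => ?_)
  · exact ((((Lp.aestronglyMeasurable _).indicator measurableSet_closedBall).sub
      (Lp.aestronglyMeasurable _)).norm.pow 2)
  · by_cases h : ξ ∈ Metric.closedBall 0 (n : ℝ) <;> simp [h]
  · obtain ⟨N, hN⟩ := exists_nat_ge ‖ξ‖
    refine tendsto_const_nhds.congr' ?_
    filter_upwards [Filter.eventually_ge_atTop N] with n hn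
    have : ξ ∈ Metric.closedBall 0 (n : ℝ) := by
      rw [mem_closedBall_zero_iff]
      exact hN.trans (by exact_mod_cast hn)
    simp [this]

/-- A lower bound of the spectrum is a lower bound of the quadratic form, not only on the operator
domain but on all functions of finite energy. -/
theorem le_energy_of_mem_lowerBounds {m α v lam : ℝ} (hα : 0 < α) (hm : 0 ≤ m) (hv : 0 < v)
    {K : Set (EuclideanSpace ℝ (Fin d))} (hK : MeasurableSet K)
    (hlam : lam ∈ lowerBounds (realSpec (wellOp m α v hK))) {f : L2 d}
    (hf : energy m α f ≠ ∞) :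
    lam * ‖f‖ ^ 2 + v * ‖indicatorMul hK f‖ ^ 2 ≤ (energy m α f).toReal := by
  have hdom : ∀ g : (wellOp m α v hK).domain,
      lam * ‖(g : L2 d)‖ ^ 2 + v * ‖indicatorMul hK (g : L2 d)‖ ^ 2 ≤
        (energy m α (g : L2 d)).toReal := fun g => by
    have h := le_re_inner_of_mem_lowerBounds_realSpec (wellOp_symm hK) (C := v) (fun u => ?_)
      hlam g
    · rw [re_inner_wellOp_self hα hm] at h
      linarith
    · rw [re_inner_wellOp_self hα hm]
      have h1 : (0 : ℝ) ≤ (energy m α (u : L2 d)).toReal := ENNReal.toReal_nonneg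
      have h2 := pow_le_pow_left₀ (norm_nonneg _) (norm_indicatorMul_le hK (u : L2 d)) 2
      nlinarith
  have ht := tendsto_fourierTruncate f
  have hc : Continuous fun g : L2 d => lam * ‖g‖ ^ 2 + v * ‖indicatorMul hK g‖ ^ 2 := by
    have := continuous_indicatorMul hK
    fun_prop
  refine le_of_tendsto ((hc.tendsto f).comp ht) (Filter.Eventually.of_forall fun n => ?_)
  exact (hdom ⟨fourierTruncate n f, fourierTruncate_mem_domain hα n f⟩).trans
    (ENNReal.toReal_mono hf (energy_fourierTruncate_le m α n f))

/-! ### Minimizers of the form -/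

/-- `f` has finite energy and the form of `L_{m,α} - v 1_K` at `f` is at most `lam ‖f‖²`. When `lam`
is a lower bound of the spectrum, equality holds and `f` minimizes the Rayleigh quotient (or is
zero). -/
def IsFormMinimizer (m α v lam : ℝ) {K : Set (EuclideanSpace ℝ (Fin d))} (hK : MeasurableSet K)
    (f : L2 d) : Prop :=
  energy m α f ≠ ∞ ∧ (energy m α f).toReal ≤ lam * ‖f‖ ^ 2 + v * ‖indicatorMul hK f‖ ^ 2

theorem isFormMinimizer_of_wellOp_eq {m α v lam : ℝ} (hα : 0 < α) (hm : 0 ≤ m)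
    {K : Set (EuclideanSpace ℝ (Fin d))} (hK : MeasurableSet K) {f : L2 d}
    (h : f ∈ (wellOp m α v hK).domain) (he : wellOp m α v hK ⟨f, h⟩ = (lam : ℂ) • f) :
    IsFormMinimizer m α v lam hK f := by
  refine ⟨(inner_freeOp_self hα hm ⟨f, h⟩).1, ?_⟩
  have h1 := re_inner_wellOp_self hα hm hK ⟨f, h⟩
  rw [he, inner_smul_left, Complex.conj_ofReal, Complex.re_ofReal_mul,
    ← RCLike.re_to_complex, inner_self_eq_norm_sq] at h1
  linarith

theorem norm_indicatorMul_eq_of_ae_eq_norm {K : Set (EuclideanSpace ℝ (Fin d))}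
    (hK : MeasurableSet K) {f g : L2 d} (h : g =ᵐ[volume] fun x => (‖f x‖ : ℂ)) :
    ‖indicatorMul hK g‖ = ‖indicatorMul hK f‖ := by
  refine norm_eq_of_ae_eq_norm ?_
  filter_upwards [h, coeFn_indicatorMul hK f, coeFn_indicatorMul hK g] with x h1 h2 h3
  rw [h2, h3]
  by_cases hx : x ∈ K <;> simp [hx, h1]

theorem norm_indicatorMul_eq_of_ae_eq_comp {K : Set (EuclideanSpace ℝ (Fin d))}
    (hK : MeasurableSet K) {f g : L2 d}
    (R : EuclideanSpace ℝ (Fin d) ≃ₗᵢ[ℝ] EuclideanSpace ℝ (Fin d)) (hR : R ⁻¹' K = K)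
    (h : g =ᵐ[volume] f ∘ R) :
    ‖indicatorMul hK g‖ = ‖indicatorMul hK f‖ := by
  refine norm_eq_of_ae_eq_comp R ?_
  filter_upwards [h, R.measurePreserving.quasiMeasurePreserving.ae_eq_comp
    (coeFn_indicatorMul hK f), coeFn_indicatorMul hK g] with x h1 h2 h3
  rw [h2, h3]
  have hx : R x ∈ K ↔ x ∈ K := by
    conv_rhs => rw [← hR]
    rfl
  by_cases hx' : x ∈ K
  · simp [hx', hx.2 hx', h1]
  · simp [hx', mt hx.1 hx']

theorem IsFormMinimizer.of_ae_eq_norm {m α v lam : ℝ} (hα₀ : 0 < α) (hα₂ : α < 2) (hm : 0 ≤ m)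
    {K : Set (EuclideanSpace ℝ (Fin d))} {hK : MeasurableSet K} {f g : L2 d}
    (hf : IsFormMinimizer m α v lam hK f) (h : g =ᵐ[volume] fun x => (‖f x‖ : ℂ)) :
    IsFormMinimizer m α v lam hK g := by
  have hle := energy_le_of_ae_eq_norm hα₀ hα₂ hm h
  refine ⟨ne_top_of_le_ne_top hf.1 hle, (ENNReal.toReal_mono hf.1 hle).trans ?_⟩
  rw [norm_eq_of_ae_eq_norm h, norm_indicatorMul_eq_of_ae_eq_norm hK h]
  exact hf.2

theorem IsFormMinimizer.of_ae_eq_comp {m α v lam : ℝ} (hα₀ : 0 < α) (hα₂ : α < 2) (hm : 0 ≤ m)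
    {K : Set (EuclideanSpace ℝ (Fin d))} {hK : MeasurableSet K} {f g : L2 d}
    (hf : IsFormMinimizer m α v lam hK f)
    (R : EuclideanSpace ℝ (Fin d) ≃ₗᵢ[ℝ] EuclideanSpace ℝ (Fin d)) (hR : R ⁻¹' K = K)
    (h : g =ᵐ[volume] f ∘ R) : IsFormMinimizer m α v lam hK g := by
  rw [IsFormMinimizer, energy_eq_of_ae_eq_comp hα₀ hα₂ hm R h, norm_eq_of_ae_eq_comp R h,
    norm_indicatorMul_eq_of_ae_eq_comp hK R hR h]
  exact hf

/-- The form minus `lam ‖·‖²` is nonnegative, so its null vectors form a linear subspace: by the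
parallelogram law the values at `f + g` and `f - g` are nonnegative with sum zero. -/
theorem IsFormMinimizer.sub {m α v lam : ℝ} (hα : 0 < α) (hm : 0 ≤ m) (hv : 0 < v)
    {K : Set (EuclideanSpace ℝ (Fin d))} {hK : MeasurableSet K}
    (hlam : lam ∈ lowerBounds (realSpec (wellOp m α v hK))) {f g : L2 d}
    (hf : IsFormMinimizer m α v lam hK f) (hg : IsFormMinimizer m α v lam hK g) :
    IsFormMinimizer m α v lam hK (f - g) := by
  have hE := energy_add_add_energy_sub (m := m) hα f g
  have hfin : 2 * (energy m α f + energy m α g) ≠ ∞ :=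
    ENNReal.mul_ne_top (by simp) (ENNReal.add_ne_top.2 ⟨hf.1, hg.1⟩)
  have hp : energy m α (f + g) ≠ ∞ := ne_top_of_le_ne_top hfin (hE ▸ le_self_add)
  have hs : energy m α (f - g) ≠ ∞ := ne_top_of_le_ne_top hfin (hE ▸ le_add_self)
  refine ⟨hs, ?_⟩
  have hE' := congrArg ENNReal.toReal hE
  rw [ENNReal.toReal_add hp hs, ENNReal.toReal_mul, ENNReal.toReal_add hf.1 hg.1,
    ENNReal.toReal_ofNat] at hE'
  have hlow := le_energy_of_mem_lowerBounds hα hm hv hK hlam hp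
  have p1 := parallelogram_law_with_norm ℂ f g
  have p2 := parallelogram_law_with_norm ℂ (indicatorMul hK f) (indicatorMul hK g)
  rw [← map_add, ← map_sub] at p2
  have q1 := congrArg (lam * ·) p1
  have q2 := congrArg (v * ·) p2
  linarith [hf.2, hg.2]

/-- A minimizer has a constant phase, since `|f|` cannot have a smaller energy. -/
theorem IsFormMinimizer.ae_eq_norm {m α v lam : ℝ} (hα₀ : 0 < α) (hα₂ : α < 2) (hm : 0 ≤ m)
    (hv : 0 < v) {K : Set (EuclideanSpace ℝ (Fin d))} {hK : MeasurableSet K}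
    (hlam : lam ∈ lowerBounds (realSpec (wellOp m α v hK))) {f : L2 d}
    (hf : IsFormMinimizer m α v lam hK f) :
    ∀ᵐ x, ∀ᵐ y, conj (f x) * f y = (‖f x‖ * ‖f y‖ : ℂ) := by
  have hmem : MemLp (fun x => (‖f x‖ : ℂ)) 2 volume := (Lp.memLp f).norm.ofReal
  have h : hmem.toLp =ᵐ[volume] fun x => (‖f x‖ : ℂ) := hmem.coeFn_toLp
  have hle := energy_le_of_ae_eq_norm hα₀ hα₂ hm h
  refine ae_eq_norm_of_energy_eq hα₀ hα₂ hm h hf.1 (hle.antisymm ?_)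
  have hfin := ne_top_of_le_ne_top hf.1 hle
  have hlow := le_energy_of_mem_lowerBounds hα₀ hm hv hK hlam hfin
  rw [norm_eq_of_ae_eq_norm h, norm_indicatorMul_eq_of_ae_eq_norm hK h] at hlow
  exact (ENNReal.toReal_le_toReal hf.1 hfin).1 (hf.2.trans hlow)

theorem ae_norm_eq_of_ae_norm_le {f g : L2 d} (hle : ∀ᵐ x, ‖f x‖ ≤ ‖g x‖) (h : ‖f‖ = ‖g‖) :
    ∀ᵐ x, ‖f x‖ = ‖g x‖ := by
  have h1 : ∫ x, ‖f x‖ ^ 2 = ∫ x, ‖g x‖ ^ 2 := by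
    rw [← norm_sq_eq_integral_of_ae_eq (Filter.EventuallyEq.refl _ f),
      ← norm_sq_eq_integral_of_ae_eq (Filter.EventuallyEq.refl _ g), h]
  have h2 := (integral_eq_iff_of_ae_le (integrable_norm_sq f) (integrable_norm_sq g)
    (hle.mono fun x hx => pow_le_pow_left₀ (norm_nonneg _) hx 2)).1 h1
  exact h2.mono fun x hx => (sq_eq_sq₀ (norm_nonneg _) (norm_nonneg _)).1 hx

theorem ae_nonneg_or_ae_nonpos {X : Type*} [MeasurableSpace X] {μ : Measure X} {r : X → ℝ}
    (h : ∀ᵐ x ∂μ, ∀ᵐ y ∂μ, 0 ≤ r x * r y) :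
    (∀ᵐ x ∂μ, 0 ≤ r x) ∨ ∀ᵐ x ∂μ, r x ≤ 0 := by
  by_cases h0 : ∀ᵐ x ∂μ, r x ≤ 0
  · exact Or.inr h0
  · obtain ⟨x, hx, hxy⟩ := ((Filter.not_eventually.1 h0).and_eventually h).exists
    exact Or.inl (hxy.mono fun y hy => nonneg_of_mul_nonneg_right hy (not_le.1 hx))

/-- The modulus of a minimizer is rotation invariant: `|f| - |f| ∘ R` is itself a minimizer, hence
of constant sign, and it vanishes because `|f|` and `|f| ∘ R` have the same norm. -/
theorem IsFormMinimizer.norm_comp_ae_eq {m α v lam : ℝ} (hα₀ : 0 < α) (hα₂ : α < 2) (hm : 0 ≤ m)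
    (hv : 0 < v) {K : Set (EuclideanSpace ℝ (Fin d))} {hK : MeasurableSet K}
    (hlam : lam ∈ lowerBounds (realSpec (wellOp m α v hK))) {f : L2 d}
    (hf : IsFormMinimizer m α v lam hK f)
    (R : EuclideanSpace ℝ (Fin d) ≃ₗᵢ[ℝ] EuclideanSpace ℝ (Fin d)) (hR : R ⁻¹' K = K) :
    ∀ᵐ x, ‖f (R x)‖ = ‖f x‖ := by
  have hmem : MemLp (fun x => (‖f x‖ : ℂ)) 2 volume := (Lp.memLp f).norm.ofReal
  set g : L2 d := hmem.toLp
  have hg : g =ᵐ[volume] fun x => (‖f x‖ : ℂ) := hmem.coeFn_toLp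
  set gR : L2 d := Lp.compMeasurePreserving R R.measurePreserving g
  have hgR : gR =ᵐ[volume] g ∘ R := Lp.coeFn_compMeasurePreserving g R.measurePreserving
  have hgR' : ∀ᵐ x, gR x = (‖f (R x)‖ : ℂ) :=
    hgR.trans (R.measurePreserving.quasiMeasurePreserving.ae_eq_comp hg)
  have hgm := hf.of_ae_eq_norm hα₀ hα₂ hm hg
  have hgRm := hgm.of_ae_eq_comp hα₀ hα₂ hm R hR hgR
  have hph := (hgm.sub hα₀ hm hv hlam hgRm).ae_eq_norm hα₀ hα₂ hm hv hlam
  have hreal : ∀ᵐ x, (g - gR : L2 d) x = ((‖f x‖ - ‖f (R x)‖ : ℝ) : ℂ) := by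
    filter_upwards [Lp.coeFn_sub g gR, hg, hgR'] with x h1 h2 h3
    rw [h1, Pi.sub_apply, h2, h3]
    push_cast
    rfl
  have hsign : ∀ᵐ x, ∀ᵐ y, 0 ≤ (‖f x‖ - ‖f (R x)‖) * (‖f y‖ - ‖f (R y)‖) := by
    filter_upwards [hph, hreal] with x h1 h2
    filter_upwards [h1, hreal] with y h3 h4
    rw [h2, h4, Complex.conj_ofReal] at h3
    have h5 : (‖f x‖ - ‖f (R x)‖) * (‖f y‖ - ‖f (R y)‖) =
      ‖((‖f x‖ - ‖f (R x)‖ : ℝ) : ℂ)‖ * ‖((‖f y‖ - ‖f (R y)‖ : ℝ) : ℂ)‖ := by exact_mod_cast h3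
    rw [h5]
    positivity
  have hn : ‖gR‖ = ‖g‖ := norm_eq_of_ae_eq_comp R hgR
  rcases ae_nonneg_or_ae_nonpos hsign with h | h
  · have hle : ∀ᵐ x, ‖gR x‖ ≤ ‖g x‖ := by
      filter_upwards [h, hg, hgR'] with x h1 h2 h3
      rw [h2, h3]
      simpa using h1
    filter_upwards [ae_norm_eq_of_ae_norm_le hle hn, hg, hgR'] with x h1 h2 h3
    rw [h2, h3] at h1
    simpa using h1
  · have hle : ∀ᵐ x, ‖g x‖ ≤ ‖gR x‖ := by
      filter_upwards [h, hg, hgR'] with x h1 h2 h3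
      rw [h2, h3]
      simpa using h1
    filter_upwards [ae_norm_eq_of_ae_norm_le hle hn.symm, hg, hgR'] with x h1 h2 h3
    rw [h2, h3] at h1
    simpa using h1.symm

theorem IsFormMinimizer.comp_ae_eq {m α v lam : ℝ} (hα₀ : 0 < α) (hα₂ : α < 2) (hm : 0 ≤ m)
    (hv : 0 < v) {K : Set (EuclideanSpace ℝ (Fin d))} {hK : MeasurableSet K}
    (hlam : lam ∈ lowerBounds (realSpec (wellOp m α v hK))) {f : L2 d}
    (hf : IsFormMinimizer m α v lam hK f)
    (R : EuclideanSpace ℝ (Fin d) ≃ₗᵢ[ℝ] EuclideanSpace ℝ (Fin d)) (hR : R ⁻¹' K = K) :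
    f ∘ R =ᵐ[volume] f := by
  have hqmp := (R.measurePreserving (E := EuclideanSpace ℝ (Fin d))).quasiMeasurePreserving
  by_cases h0 : ∀ᵐ x, f x = 0
  · filter_upwards [h0, hqmp.ae h0] with x h1 h2
    rw [Function.comp_apply, h1, h2]
  obtain ⟨x₀, hx₀, hph⟩ := ((Filter.not_eventually.1 h0).and_eventually
    (hf.ae_eq_norm hα₀ hα₂ hm hv hlam)).exists
  have hc : conj (f x₀) ≠ 0 := (map_ne_zero _).2 hx₀
  filter_upwards [hph, hqmp.ae hph, hf.norm_comp_ae_eq hα₀ hα₂ hm hv hlam R hR] with x h1 h2 h3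
  refine mul_left_cancel₀ hc ?_
  rw [Function.comp_apply, h1, h2, h3]

/-! ### Passage to a pointwise rotation invariant version -/

/-- A locally integrable function invariant almost everywhere under each isometry (with an
exceptional set depending on the isometry) has a version invariant at every point: the limit of its averages
over balls centred at `x`. -/
theorem exists_rotationallySymmetric_ae_eq {f : EuclideanSpace ℝ (Fin d) → ℂ}
    (hf : LocallyIntegrable f)
    (h : ∀ R : EuclideanSpace ℝ (Fin d) ≃ₗᵢ[ℝ] EuclideanSpace ℝ (Fin d), f ∘ R =ᵐ[volume] f) :
    ∃ g : EuclideanSpace ℝ (Fin d) → ℂ, g =ᵐ[volume] f ∧ RotationallySymmetric g := by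
  have havg : ∀ (R : EuclideanSpace ℝ (Fin d) ≃ₗᵢ[ℝ] EuclideanSpace ℝ (Fin d))
      (x : EuclideanSpace ℝ (Fin d)) (r : ℝ),
      ⨍ y in Metric.closedBall (R x) r, f y = ⨍ y in Metric.closedBall x r, f y := fun R x r => by
    have hpre : R ⁻¹' Metric.closedBall (R x) r = Metric.closedBall x r := by
      rw [R.isometry.preimage_closedBall]
    have hmp := R.measurePreserving (E := EuclideanSpace ℝ (Fin d))
    rw [setAverage_eq, setAverage_eq, ← hmp.setIntegral_preimage_emb
      R.toMeasurableEquiv.measurableEmbedding, hpre, measureReal_def, measureReal_def, ← hpre,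
      hmp.measure_preimage measurableSet_closedBall.nullMeasurableSet, hpre]
    congr 1
    exact integral_congr_ae (ae_restrict_of_ae (h R))
  -- `limUnder` has a junk value where the averages diverge, but the averages at `x` and at `R x`
  -- are the same function of the radius, so it is rotation invariant there too
  refine ⟨fun x => Filter.limUnder (nhdsWithin (0 : ℝ) (Set.Ioi 0))
    fun r => ⨍ y in Metric.closedBall x r, f y, ?_, fun R x => ?_⟩
  · filter_upwards [IsUnifLocDoublingMeasure.ae_tendsto_average (μ := volume) hf 0] with x hx
    refine (hx (fun _ => x) (fun r => r) Filter.tendsto_id ?_).limUnder_eq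
    filter_upwards with r
    simp
  · simp only [havg R x]

end RelSchrodinger

end

theorem theorem4p3 (d : ℕ) (hd : 1 ≤ d) (α : ℝ) (hα₀ : 0 < α) (hα₂ : α < 2)
    (m : ℝ) (hm : 0 ≤ m) (v : ℝ) (hv : 0 < v) (a : ℝ) (ha : 0 < a)
    (φ : RelSchrodinger.L2 d)
    (hφ : RelSchrodinger.IsGroundState
      (RelSchrodinger.wellOp m α v
        (measurableSet_ball : MeasurableSet (Metric.ball (0 : EuclideanSpace ℝ (Fin d)) a))) φ) :
    (∃ f : EuclideanSpace ℝ (Fin d) → ℂ,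
      f =ᵐ[volume] φ ∧ RelSchrodinger.RotationallySymmetric f) ∧
    (∀ f : EuclideanSpace ℝ (Fin d) → ℂ,
      f =ᵐ[volume] φ → Continuous f → RelSchrodinger.RotationallySymmetric f) := by
  obtain ⟨-, lam, hlam, hmem, heq⟩ := hφ
  have hmin := RelSchrodinger.isFormMinimizer_of_wellOp_eq hα₀ hm measurableSet_ball hmem heq
  have hrot : ∀ R : EuclideanSpace ℝ (Fin d) ≃ₗᵢ[ℝ] EuclideanSpace ℝ (Fin d),
      φ ∘ R =ᵐ[volume] φ := fun R =>
    hmin.comp_ae_eq hα₀ hα₂ hm hv hlam.1 R (by ext x; simp)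
  refine ⟨RelSchrodinger.exists_rotationallySymmetric_ae_eq
    ((Lp.memLp φ).locallyIntegrable one_le_two) hrot, fun f hf hcont R x => ?_⟩
  have hae : f ∘ R =ᵐ[volume] f :=
    (R.measurePreserving.quasiMeasurePreserving.ae_eq_comp hf).trans ((hrot R).trans hf.symm)
  exact congrFun ((hcont.comp R.continuous).ae_eq_iff_eq volume hcont |>.1 hae) x
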